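/- Let $m\ge 0$, $p>q\ge 0$ be integers. Write $\wedge^p$ for the space of smooth skewsymmetric contravariant tensor fields of degree $p$ on $\mathbb R^m$, $\mathcal D^k=\mathcal D^k(\wedge^p,\wedge^q)$ for the differential operators of order at most $k$ from $\wedge^p$ to $\wedge^q$, and $\mathcal S^1=C^\infty(\mathbb R^m,\mathbb R^m\otimes \mathrm{Hom}(\wedge^p\mathbb R^m,\wedge^q\mathbb R^m))$ for the space of principal symbols of order $1$, all with the action of vector fields by Lie derivative. Let $sl_{m+1}$ be the Lie algebra of the vector fields $-h^i\partial_i-A^i_jx^j\partial_i+\alpha(x)x^i\partial_i$ on $\mathbb R^m$ ($h\in\mathbb R^m$, $A\in \mathfrak{gl}(m,\mathbb R)$, $\alpha\in\mathbb R^{m*}$), and let $$\theta: H^n(sl_{m+1},\mathcal S^1)\to H^{n+1}(sl_{m+1},\mathcal D^0)$$ be the connecting homomorphism of the exact sequence $0\to\mathcal D^0\to\mathcal D^1\xrightarrow{\sigma}\mathcal S^1\to 0$, for the Chevalley–Eilenberg differential $$(\partial c)(X_0,\dots,X_n)=\sum_i(-1)^iL_{X_i}c(\dots,\hat X_i,\dots)+\sum_{i<j}(-1)^{i+j}c([X_i,X_j],\dots,\hat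 X_i,\dots,\hat X_j,\dots).$$ For $\gamma\in\wedge^t\mathfrak{gl}(m,\mathbb R)^*$ and an alternating $u$-linear map $I$ on $\mathbb R^{m*}$ with values in a representation $V$ of $\mathfrak{gl}(m,\mathbb R)$, let $\chi(\gamma\otimes I)$ be the $(t+u)$-cochain on $sl_{m+1}$ with values in $C^\infty(\mathbb R^m,V)$ $$\chi(\gamma\otimes I)(X_0,\dots,X_{t+u-1})=\frac{(-1)^t}{t!\,u!\,(m+1)^u}\sum_\nu \mathrm{sign}(\nu)\,\gamma(DX_{\nu_0},\dots,DX_{\nu_{t-1}})\,I(d\,\mathrm{tr}DX_{\nu_t},\dots,d\,\mathrm{tr}DX_{\nu_{t+u-1}}),$$ where $\nu$ runs over the permutations of $\{0,\dots,t+u-1\}$. Put $$I_0(\alpha_1,\dots,\alpha_{p-q})(T)=i_{\alpha_1}\cdots i_{\alpha_{p-q}}T,\qquad I_1(\alpha_1,\dots,\alpha_{p-q-1})(\eta)(T)=i_\eta i_{\alpha_1}\cdots i_{\alpha_{p-q-1}}T$$ for $T\in\wedge^p\mathbb R^m$ and $\eta,\alpha_j\in\mathbb R^{m*}$, where $(i_\alpha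 T)(\beta_1,\beta_2,\dots)=T(\alpha,\beta_1,\beta_2,\dots)$. Then, for every $a\ge 0$ and every $\gamma\in(\wedge^a\mathfrak{gl}(m,\mathbb R)^*)_{\mathfrak{gl}\text{-inv}}$, the cochains $\chi(\gamma\otimes I_1)$ (with values in $\mathcal S^1$) and $\chi(\gamma\otimes I_0)$ (with values in $C^\infty(\mathbb R^m,\mathrm{Hom}(\wedge^p\mathbb R^m,\wedge^q\mathbb R^m))=\mathcal D^0$) are cocycles and $$\theta\big([\chi(\gamma\otimes I_1)]\big)=(-1)^{a}\,(p-q)\,(m+1)\,[\chi(\gamma\otimes I_0)].$$ In other words, when invariant forms $\gamma$ are identified with classes in the source of $\theta$ by $\gamma\mapsto[\chi(\gamma\otimes I_1)]$ and with classes in its target by $\gamma\mapsto[\chi(\gamma\otimes I_0)]$, one has $\theta(\gamma)=(-1)^{|\gamma|}(p-q)(m+1)\gamma$. -/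

import Mathlib

open scoped ContDiff

set_option maxSynthPendingDepth 3

noncomputable section

section Alternating

variable {R L N : Type*} [CommRing R] [AddCommGroup L] [Module R L] [AddCommGroup N] [Module R N]

/-- The derivation of the space of alternating maps induced by `D`:
`c ↦ ((x₁, …, xₙ) ↦ ∑ j, c (x₁, …, D xⱼ, …, xₙ))`. -/
def altDer (D : L →ₗ[R] L) {n : ℕ} (c : L [⋀^Fin n]→ₗ[R] N) : L [⋀^Fin n]→ₗ[R] N where
  toFun x := ∑ j, c (Function.update x j (D (x j)))
  map_update_add' := by
    intro inst x i a b
    obtain rfl : inst = instDecidableEqFin n := Subsingleton.elim _ _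
    rw [← Finset.sum_add_distrib]
    refine Finset.sum_congr rfl fun j _ => ?_
    rcases eq_or_ne j i with rfl | h
    · simp only [Function.update_self, Function.update_idem, map_add, map_smul,
        AlternatingMap.map_update_add, AlternatingMap.map_update_smul]
    · simp [Function.update_of_ne h, Function.update_comm h.symm]
  map_update_smul' := by
    intro inst x i r a
    obtain rfl : inst = instDecidableEqFin n := Subsingleton.elim _ _
    rw [Finset.smul_sum]
    refine Finset.sum_congr rfl fun j _ => ?_
    rcases eq_or_ne j i with rfl | h
    · simp only [Function.update_self, Function.update_idem, map_add, map_smul,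
        AlternatingMap.map_update_add, AlternatingMap.map_update_smul]
    · simp [Function.update_of_ne h, Function.update_comm h.symm]
  map_eq_zero_of_eq' := by
    intro x i j hx hij
    rw [← Finset.add_sum_erase _ _ (Finset.mem_univ i),
      ← Finset.add_sum_erase _ _ (Finset.mem_erase.2 ⟨hij.symm, Finset.mem_univ j⟩),
      Finset.sum_eq_zero, add_zero]
    · have h : Function.update x j (D (x j))
          = (Function.update x i (D (x i))) ∘ Equiv.swap i j := by
        ext k
        rcases eq_or_ne k i with rfl | hki
        · simp [hij, Function.update_of_ne hij.symm, hx]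
        rcases eq_or_ne k j with rfl | hkj
        · simp [hx]
        · simp [Equiv.swap_apply_of_ne_of_ne hki hkj, hki, hkj]
      rw [h, AlternatingMap.map_swap _ _ hij, add_neg_cancel]
    · intro k hk
      simp only [Finset.mem_erase, Finset.mem_univ, and_true, ne_eq] at hk
      refine c.map_eq_zero_of_eq _ ?_ hij
      rw [Function.update_of_ne (Ne.symm hk.2), Function.update_of_ne (Ne.symm hk.1), hx]

theorem altDer_apply (D : L →ₗ[R] L) {n : ℕ} (c : L [⋀^Fin n]→ₗ[R] N) (x : Fin n → L) :
    altDer D c x = ∑ j, c (Function.update x j (D (x j))) := rfl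

/-- Uncurrying in the first variable. -/
theorem exists_alt_uncurry {n : ℕ} (F : L →ₗ[R] L [⋀^Fin n]→ₗ[R] N)
    (hF : ∀ (x : L) (v : Fin n → L) (j : Fin n), v j = x → F x v = 0) :
    ∃ a : L [⋀^Fin (n + 1)]→ₗ[R] N, ∀ v, a v = F (v 0) (Fin.tail v) := by
  refine ⟨{ (LinearMap.uncurryLeft (M := fun _ : Fin (n + 1) => L)
      (AlternatingMap.toMultilinearMapLM.comp F)) with
    map_eq_zero_of_eq' := ?_ }, fun v => rfl⟩
  intro v i j hv hij
  change F (v 0) (Fin.tail v) = 0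
  induction i using Fin.cases with
  | zero =>
    induction j using Fin.cases with
    | zero => exact absurd rfl hij
    | succ j => exact hF _ _ j hv.symm
  | succ i =>
    induction j using Fin.cases with
    | zero => exact hF _ _ i hv
    | succ j => exact (F (v 0)).map_eq_zero_of_eq _ hv (fun h => hij (by rw [h]))

end Alternating

/-! ### The Chevalley–Eilenberg complex -/

namespace CE

variable {K L M : Type*} [Field K] [LieRing L] [LieAlgebra K L]
  [AddCommGroup M] [Module K M] [LieRingModule L M] [LieModule K L M]

/-- The Lie derivative of cochains,
`(L_z c)(x₁, …, x_n) = ⁅z, c(x₁, …, x_n)⁆ - ∑ j, c(x₁, …, ⁅z, xⱼ⁆, …, x_n)`. -/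
def lieCochain {n : ℕ} (z : L) (c : L [⋀^Fin n]→ₗ[K] M) : L [⋀^Fin n]→ₗ[K] M :=
  (LieModule.toEnd K L M z).compAlternatingMap c - altDer (LieAlgebra.ad K L z) c

theorem lieCochain_apply {n : ℕ} (z : L) (c : L [⋀^Fin n]→ₗ[K] M) (x : Fin n → L) :
    lieCochain z c x = ⁅z, c x⁆ - ∑ j, c (Function.update x j ⁅z, x j⁆) := rfl

/-- The Chevalley–Eilenberg coboundary, as a function:
`(∂c)(x₀, …, x_n) = ∑ i, (-1)^i ⁅xᵢ, c(x₀, …, x̂ᵢ, …, x_n)⁆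
  + ∑ i < j, (-1)^(i+j) c(⁅xᵢ, xⱼ⁆, x₀, …, x̂ᵢ, …, x̂ⱼ, …, x_n)`.
In the second sum the bracket is kept in the place of `xⱼ` instead of being moved to the first
place; as it moves over `j - 1` arguments, the sign `(-1)^(i+j)` becomes `-(-1)^i`. -/
def dFun {n : ℕ} (c : L [⋀^Fin n]→ₗ[K] M) (x : Fin (n + 1) → L) : M :=
  ∑ i : Fin (n + 1), (-1 : K) ^ (i : ℕ) •
    (⁅x i, c (i.removeNth x)⁆
      - ∑ j ∈ Finset.Ioi i, c (i.removeNth (Function.update x j ⁅x i, x j⁆)))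

theorem dFun_zero (c : L [⋀^Fin 0]→ₗ[K] M) (x : Fin 1 → L) :
    dFun c x = ⁅x 0, c ![]⁆ := by
  have : (Finset.Ioi (0 : Fin 1)) = ∅ := by decide
  simp [dFun, this]
  congr 2
  exact Subsingleton.elim _ _

theorem dFun_succ {n : ℕ} (c : L [⋀^Fin (n + 1)]→ₗ[K] M) (x : Fin (n + 2) → L) :
    dFun c x = lieCochain (x 0) c (Fin.tail x) - dFun (c.curryLeft (x 0)) (Fin.tail x) := by
  rw [dFun, Fin.sum_univ_succ, sub_eq_add_neg (lieCochain _ _ _), lieCochain_apply, dFun,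
    ← Finset.sum_neg_distrib]
  congr 1
  · simp only [Fin.val_zero, pow_zero, one_smul]
    congr 1
    have : Finset.Ioi (0 : Fin (n + 2)) = Finset.univ.map (Fin.succEmb (n + 1)) := by
      ext k; simp [Fin.pos_iff_ne_zero, Fin.exists_succ_eq]
    rw [this, Finset.sum_map]
    refine Finset.sum_congr rfl fun j _ => ?_
    congr 1
    simp only [Fin.removeNth_zero]
    simp [Fin.tail_update_succ, Fin.tail]
  · refine Finset.sum_congr rfl fun i _ => ?_
    have hI : Finset.Ioi i.succ = (Finset.Ioi i).map (Fin.succEmb (n + 1)) := by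
      ext k
      induction k using Fin.cases with
      | zero => simp
      | succ k => simp
    have hr : ∀ y : Fin (n + 2) → L, i.succ.removeNth y
        = Matrix.vecCons (y 0) (i.removeNth (Fin.tail y)) := by
      intro y
      ext k
      induction k using Fin.cases with
      | zero => simp [Fin.removeNth]
      | succ k => simp [Fin.removeNth, Fin.tail]
    rw [hI, Finset.sum_map, Fin.val_succ, pow_succ, mul_neg_one, neg_smul]
    congr 3
    · simp [hr, Fin.tail]
    · refine Finset.sum_congr rfl fun j _ => ?_
      simp only [Fin.coe_succEmb, hr, Fin.tail_update_succ]
      rw [Function.update_of_ne (Fin.succ_ne_zero j).symm]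
      rfl

theorem dFun_add {n : ℕ} (c c' : L [⋀^Fin n]→ₗ[K] M) (x : Fin (n + 1) → L) :
    dFun (c + c') x = dFun c x + dFun c' x := by
  simp only [dFun, AlternatingMap.add_apply, lie_add, Finset.sum_add_distrib,
    ← Finset.sum_add_distrib, ← smul_add]
  refine Finset.sum_congr rfl fun i _ => ?_
  rw [Finset.sum_add_distrib]
  congr 1
  abel

theorem dFun_smul {n : ℕ} (r : K) (c : L [⋀^Fin n]→ₗ[K] M) (x : Fin (n + 1) → L) :
    dFun (r • c) x = r • dFun c x := by
  simp only [dFun, AlternatingMap.smul_apply, lie_smul, Finset.smul_sum]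
  refine Finset.sum_congr rfl fun i _ => ?_
  rw [← Finset.smul_sum, ← smul_sub, smul_comm]

theorem lieCochain_curryLeft {n : ℕ} (z y : L) (c : L [⋀^Fin (n + 1)]→ₗ[K] M) :
    (lieCochain z c).curryLeft y = lieCochain z (c.curryLeft y) - c.curryLeft ⁅z, y⁆ := by
  ext x
  simp only [AlternatingMap.curryLeft_apply_apply, lieCochain_apply, AlternatingMap.sub_apply]
  rw [Fin.sum_univ_succ]
  simp only [Matrix.cons_val_zero, Matrix.cons_val_succ]
  have h0 : Function.update (Matrix.vecCons y x) 0 ⁅z, y⁆ = Matrix.vecCons ⁅z, y⁆ x :=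
    Fin.update_cons_zero _ _ _
  have h1 : ∀ j, Function.update (Matrix.vecCons y x) (Fin.succ j) ⁅z, x j⁆
      = Matrix.vecCons y (Function.update x j ⁅z, x j⁆) := fun j =>
    (Fin.cons_update _ _ _ _).symm
  rw [h0]
  simp only [h1]
  abel

theorem exists_d {n : ℕ} (c : L [⋀^Fin n]→ₗ[K] M) :
    ∃ a : L [⋀^Fin (n + 1)]→ₗ[K] M, ∀ x, a x = dFun c x := by
  induction n with
  | zero =>
    refine ⟨AlternatingMap.ofSubsingleton K L M (0 : Fin 1)
      { toFun := fun y => ⁅y, c ![]⁆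
        map_add' := fun y z => add_lie y z _
        map_smul' := fun r y => smul_lie r y _ }, fun x => ?_⟩
    rw [dFun_zero]
    rfl
  | succ n ih =>
    choose a ha using ih
    let F : L →ₗ[K] L [⋀^Fin (n + 1)]→ₗ[K] M :=
      { toFun := fun y => lieCochain y c - a (c.curryLeft y)
        map_add' := by
          intro y z
          ext x
          simp only [AlternatingMap.sub_apply, AlternatingMap.add_apply, ha, map_add, dFun_add,
            lieCochain_apply, add_lie, AlternatingMap.map_update_add, Finset.sum_add_distrib]
          abel
        map_smul' := by
          intro r z
          ext x
          simp only [AlternatingMap.sub_apply, AlternatingMap.smul_apply, ha, map_smul, dFun_smul,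
            lieCochain_apply, smul_lie, AlternatingMap.map_update_smul, RingHom.id_apply,
            ← Finset.smul_sum, smul_sub] }
    have hF0 : ∀ (y : L) (v : Fin (n + 1) → L), v 0 = y → F y v = 0 := by
      intro y v hv
      change lieCochain y c v - a (c.curryLeft y) v = 0
      have h1 : lieCochain y c v = lieCochain y (c.curryLeft y) (Fin.tail v) := by
        have h := congrArg (fun f => f (Fin.tail v)) (lieCochain_curryLeft y y c)
        simp only [lie_self, map_zero, sub_zero, AlternatingMap.curryLeft_apply_apply] at h
        rw [← h]
        congr 1
        rw [← hv]
        exact (Fin.cons_self_tail v).symm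
      rw [h1, ha]
      cases n with
      | zero =>
        rw [dFun_zero, hv, lieCochain_apply]
        simp only [Finset.univ_eq_empty, Finset.sum_empty, sub_zero]
        rw [Subsingleton.elim (Fin.tail v) ![], sub_self]
      | succ n =>
        rw [dFun_succ, hv, AlternatingMap.curryLeft_same]
        have : dFun (0 : L [⋀^Fin n]→ₗ[K] M) (Fin.tail v) = 0 := by simp [dFun]
        rw [this, sub_zero, sub_self]
    obtain ⟨b, hb⟩ := exists_alt_uncurry F (by
      intro y v j hv
      rcases eq_or_ne j 0 with rfl | hj
      · exact hF0 y v hv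
      · have := (F y).map_swap v hj
        rw [← neg_eq_zero, ← this]
        refine hF0 _ _ ?_
        simp [hv])
    refine ⟨b, fun x => ?_⟩
    rw [hb, dFun_succ, ← ha]
    rfl

/-- The Chevalley–Eilenberg differential. -/
def d (n : ℕ) : (L [⋀^Fin n]→ₗ[K] M) →ₗ[K] (L [⋀^Fin (n + 1)]→ₗ[K] M) where
  toFun c :=
    { toFun := dFun c
      map_update_add' := by
        intro inst x i a b
        obtain ⟨f, hf⟩ := exists_d c
        simp only [← hf, AlternatingMap.map_update_add]
      map_update_smul' := by
        intro inst x i a b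
        obtain ⟨f, hf⟩ := exists_d c
        simp only [← hf, AlternatingMap.map_update_smul]
      map_eq_zero_of_eq' := by
        intro x i j h hij
        obtain ⟨f, hf⟩ := exists_d c
        simp only [← hf]
        exact f.map_eq_zero_of_eq x h hij }
  map_add' c c' := AlternatingMap.ext fun x => dFun_add c c' x
  map_smul' r c := AlternatingMap.ext fun x => dFun_smul r c x

theorem d_apply {n : ℕ} (c : L [⋀^Fin n]→ₗ[K] M) (x : Fin (n + 1) → L) :
    d n c x = ∑ i : Fin (n + 1), (-1 : K) ^ (i : ℕ) •
      (⁅x i, c (i.removeNth x)⁆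
        - ∑ j ∈ Finset.Ioi i, c (i.removeNth (Function.update x j ⁅x i, x j⁆))) := rfl

theorem curryLeft_ext {n : ℕ} {a b : L [⋀^Fin (n + 1)]→ₗ[K] M}
    (h : ∀ y, a.curryLeft y = b.curryLeft y) : a = b := by
  ext x
  have := congrArg (fun f => f (Fin.tail x)) (h (x 0))
  simp only [AlternatingMap.curryLeft_apply_apply] at this
  rwa [show Matrix.vecCons (x 0) (Fin.tail x) = x from Fin.cons_self_tail x] at this

theorem d_curryLeft {n : ℕ} (c : L [⋀^Fin (n + 1)]→ₗ[K] M) (y : L) :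
    (d (n + 1) c).curryLeft y = lieCochain y c - d n (c.curryLeft y) := by
  ext x
  exact dFun_succ c (Matrix.vecCons y x)

theorem d_zero_curryLeft (c : L [⋀^Fin 0]→ₗ[K] M) (y : L) :
    (d 0 c).curryLeft y = lieCochain y c := by
  ext x
  refine (dFun_zero c (Matrix.vecCons y x)).trans ?_
  rw [lieCochain_apply]
  simp only [Finset.univ_eq_empty, Finset.sum_empty, sub_zero]
  rw [Subsingleton.elim x ![]]
  rfl

theorem lieCochain_add {n : ℕ} (z : L) (c c' : L [⋀^Fin n]→ₗ[K] M) :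
    lieCochain z (c + c') = lieCochain z c + lieCochain z c' := by
  ext x
  simp only [lieCochain_apply, AlternatingMap.add_apply, lie_add, Finset.sum_add_distrib]
  abel

theorem lieCochain_sub {n : ℕ} (z : L) (c c' : L [⋀^Fin n]→ₗ[K] M) :
    lieCochain z (c - c') = lieCochain z c - lieCochain z c' := by
  ext x
  simp only [lieCochain_apply, AlternatingMap.sub_apply, lie_sub, Finset.sum_sub_distrib]
  abel

theorem lieCochain_comm {n : ℕ} (y z : L) (c : L [⋀^Fin n]→ₗ[K] M) :
    lieCochain y (lieCochain z c) - lieCochain z (lieCochain y c) = lieCochain ⁅y, z⁆ c := by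
  induction n with
  | zero =>
    ext x
    simp [lieCochain_apply]
  | succ n ih =>
    refine curryLeft_ext fun w => ?_
    rw [← AlternatingMap.curryLeftLinearMap_apply, map_sub, LinearMap.sub_apply]
    simp only [AlternatingMap.curryLeftLinearMap_apply, lieCochain_curryLeft, lieCochain_sub,
      ← ih, lie_lie, map_sub]
    abel

theorem lieCochain_d {n : ℕ} (z : L) (c : L [⋀^Fin n]→ₗ[K] M) :
    lieCochain z (d n c) = d n (lieCochain z c) := by
  induction n with
  | zero =>
    refine curryLeft_ext fun w => ?_
    rw [lieCochain_curryLeft, d_zero_curryLeft, d_zero_curryLeft, d_zero_curryLeft,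
      ← lieCochain_comm]
    abel
  | succ n ih =>
    refine curryLeft_ext fun w => ?_
    simp only [lieCochain_curryLeft, d_curryLeft, lieCochain_sub, ih, map_sub,
      ← lieCochain_comm z w]
    abel

/-- The differential squares to zero. -/
theorem d_d {n : ℕ} (c : L [⋀^Fin n]→ₗ[K] M) : d (n + 1) (d n c) = 0 := by
  induction n with
  | zero =>
    refine curryLeft_ext fun w => ?_
    rw [d_curryLeft, d_zero_curryLeft, lieCochain_d, sub_self, AlternatingMap.curryLeft_zero]
    rfl
  | succ n ih =>
    refine curryLeft_ext fun w => ?_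
    rw [d_curryLeft, d_curryLeft, map_sub, ih, lieCochain_d, sub_zero, sub_self,
      AlternatingMap.curryLeft_zero]
    rfl


section Cohomology

variable (K L M)

/-- `n`-cocycles of `L` with coefficients in `M`. -/
def cocycles (n : ℕ) : Submodule K (L [⋀^Fin n]→ₗ[K] M) := LinearMap.ker (d n)

/-- `n`-coboundaries of `L` with coefficients in `M` (none but `0` in degree `0`). -/
def coboundaries : (n : ℕ) → Submodule K (L [⋀^Fin n]→ₗ[K] M)
  | 0 => ⊥
  | n + 1 => LinearMap.range (d n)

/-- The cohomology space `Hⁿ(L, M)`: cocycles modulo coboundaries. -/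
abbrev H (n : ℕ) : Type _ :=
  cocycles K L M n ⧸ (coboundaries K L M n).submoduleOf (cocycles K L M n)

variable {K L M}

/-- The class of a cocycle. -/
def cls {n : ℕ} (c : L [⋀^Fin n]→ₗ[K] M) (hc : c ∈ cocycles K L M n) : H K L M n :=
  Submodule.Quotient.mk ⟨c, hc⟩

end Cohomology

section Connecting

variable {A B C : Type*}
  [AddCommGroup A] [Module K A] [LieRingModule L A] [LieModule K L A]
  [AddCommGroup B] [Module K B] [LieRingModule L B] [LieModule K L B]
  [AddCommGroup C] [Module K C] [LieRingModule L C] [LieModule K L C]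

theorem d_comp {n : ℕ} (f : A →ₗ⁅K,L⁆ B) (c : L [⋀^Fin n]→ₗ[K] A) :
    d n ((f : A →ₗ[K] B).compAlternatingMap c) = (f : A →ₗ[K] B).compAlternatingMap (d n c) := by
  ext x
  simp [d_apply, map_sub]

variable (i : A →ₗ⁅K,L⁆ B) (p : B →ₗ⁅K,L⁆ C)

/-- A linear section of `p`. -/
def linSection (hp : Function.Surjective p) : C →ₗ[K] B :=
  ((p : B →ₗ[K] C).exists_rightInverse_of_surjective (LinearMap.range_eq_top.2 hp)).choose

theorem linSectionspec (hp : Function.Surjective p) (c : C) : p (linSection p hp c) = c :=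
  LinearMap.congr_fun ((p : B →ₗ[K] C).exists_rightInverse_of_surjective
    (LinearMap.range_eq_top.2 hp)).choose_spec c

/-- A linear retraction of `i`. -/
def retr (hi : Function.Injective i) : B →ₗ[K] A :=
  ((i : A →ₗ[K] B).exists_leftInverse_of_injective (LinearMap.ker_eq_bot.2 hi)).choose

theorem retr_spec (hi : Function.Injective i) (a : A) : retr i hi (i a) = a :=
  LinearMap.congr_fun ((i : A →ₗ[K] B).exists_leftInverse_of_injective
    (LinearMap.ker_eq_bot.2 hi)).choose_spec a

variable {i p} (hi : Function.Injective i) (hp : Function.Surjective p)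

theorem comp_retr {n : ℕ} (hex : Function.Exact i p) (b : L [⋀^Fin n]→ₗ[K] B)
    (hb : (p : B →ₗ[K] C).compAlternatingMap b = 0) :
    (i : A →ₗ[K] B).compAlternatingMap ((retr i hi).compAlternatingMap b) = b := by
  ext x
  obtain ⟨a, ha⟩ := (hex (b x)).1 (AlternatingMap.congr_fun hb x)
  change i (retr i hi (b x)) = b x
  rw [← ha, retr_spec]

theorem comp_inj {n : ℕ} (hi : Function.Injective i) {a a' : L [⋀^Fin n]→ₗ[K] A}
    (h : (i : A →ₗ[K] B).compAlternatingMap a = (i : A →ₗ[K] B).compAlternatingMap a') : a = a' :=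
  AlternatingMap.ext fun x => hi (AlternatingMap.congr_fun h x)

/-- Lift the cochain along `p`, apply the differential, pull back along `i`. -/
def connCochain (n : ℕ) : (L [⋀^Fin n]→ₗ[K] C) →ₗ[K] (L [⋀^Fin (n + 1)]→ₗ[K] A) where
  toFun c := (retr i hi).compAlternatingMap (d n ((linSection p hp).compAlternatingMap c))
  map_add' c c' := by
    have h : (linSection p hp).compAlternatingMap (c + c') = (linSection p hp).compAlternatingMap c
      + (linSection p hp).compAlternatingMap c' := by ext; simp
    rw [h, map_add]
    ext; simp
  map_smul' r c := by
    have h : (linSection p hp).compAlternatingMap (r • c)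
      = r • (linSection p hp).compAlternatingMap c := by ext; simp
    rw [h, map_smul]
    ext; simp

theorem comp_connCochain {n : ℕ} (hex : Function.Exact i p) (c : L [⋀^Fin n]→ₗ[K] C) (hc : d n c = 0) :
    (i : A →ₗ[K] B).compAlternatingMap (connCochain (i := i) hi hp n c)
      = d n ((linSection p hp).compAlternatingMap c) := by
  refine comp_retr hi hex _ ?_
  rw [← d_comp, ← hc]
  congr 1
  ext x
  exact linSectionspec p hp _

theorem connCochain_mem {n : ℕ} (hex : Function.Exact i p) (c : L [⋀^Fin n]→ₗ[K] C) (hc : c ∈ cocycles K L C n) :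
    connCochain (i := i) hi hp n c ∈ cocycles K L A (n + 1) := by
  refine comp_inj hi ?_
  rw [← d_comp, comp_connCochain hi hp hex c hc, d_d]
  ext
  simp

theorem conn_coboundary {n : ℕ} (hi : Function.Injective i)
    (hex : Function.Exact i p) (b : L [⋀^Fin n]→ₗ[K] B) (a : L [⋀^Fin (n + 1)]→ₗ[K] A)
    (hb : (p : B →ₗ[K] C).compAlternatingMap b ∈ coboundaries K L C n)
    (ha : (i : A →ₗ[K] B).compAlternatingMap a = d n b) (hp : Function.Surjective p) :
    a ∈ coboundaries K L A (n + 1) := by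
  have key : ∀ b' : L [⋀^Fin n]→ₗ[K] B, d n b' = 0 →
      (p : B →ₗ[K] C).compAlternatingMap (b - b') = 0 → a ∈ coboundaries K L A (n + 1) := by
    intro b' hb' h
    refine ⟨(retr i hi).compAlternatingMap (b - b'), comp_inj hi ?_⟩
    rw [← d_comp, comp_retr hi hex _ h, map_sub, hb', sub_zero, ha]
  cases n with
  | zero => exact key 0 (map_zero _) (by rw [sub_zero]; exact hb)
  | succ n =>
    obtain ⟨y, hy⟩ := hb
    refine key (d n ((linSection p hp).compAlternatingMap y)) (d_d _) ?_
    have h1 : (p : B →ₗ[K] C).compAlternatingMap (d n ((linSection p hp).compAlternatingMap y))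
        = d n y := by
      rw [← d_comp]
      congr 1
      ext x
      exact linSectionspec p hp _
    ext x
    have h2 := AlternatingMap.congr_fun (h1.trans hy) x
    simp only [LinearMap.compAlternatingMap_apply, AlternatingMap.sub_apply, map_sub] at h2 ⊢
    rw [h2, sub_self]
    rfl

/-- The connecting homomorphism `Hⁿ(L, C) → Hⁿ⁺¹(L, A)` of a short exact sequence
`0 → A → B → C → 0` of `L`-modules. -/
def connecting (hex : Function.Exact i p) (n : ℕ) : H K L C n →ₗ[K] H K L A (n + 1) :=
  Submodule.mapQ _ _
    ((connCochain (i := i) hi hp n).restrict fun c hc => connCochain_mem hi hp hex c hc) <| by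
    intro c hc
    refine conn_coboundary hi hex ((linSection p hp).compAlternatingMap c.1) _ ?_
      (comp_connCochain hi hp hex c.1 c.2) hp
    convert (show c.1 ∈ coboundaries K L C n from hc)
    ext x
    exact linSectionspec p hp _

/-- `connecting` is computed by lifting a cocycle `c` of `C` to any cochain `b` of `B`:
its value on the class of `c` is the class of the cocycle `a` of `A` such that `i a = d b`. -/
theorem connecting_cls (hex : Function.Exact i p) {n : ℕ}
    (c : L [⋀^Fin n]→ₗ[K] C) (hc : c ∈ cocycles K L C n)
    (b : L [⋀^Fin n]→ₗ[K] B) (hb : (p : B →ₗ[K] C).compAlternatingMap b = c)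
    (a : L [⋀^Fin (n + 1)]→ₗ[K] A) (ha : (i : A →ₗ[K] B).compAlternatingMap a = d n b)
    (hac : a ∈ cocycles K L A (n + 1)) :
    connecting hi hp hex n (cls c hc) = cls a hac := by
  refine (Submodule.Quotient.eq _).2 ?_
  refine conn_coboundary hi hex ((linSection p hp).compAlternatingMap c - b) _ ?_ ?_ hp
  · convert Submodule.zero_mem (coboundaries K L C n)
    ext x
    have h2 := AlternatingMap.congr_fun hb x
    simp only [LinearMap.compAlternatingMap_apply, AlternatingMap.sub_apply, map_sub] at h2 ⊢
    rw [h2]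
    exact sub_eq_zero.2 (linSectionspec p hp _)
  · refine Eq.trans ?_ (map_sub (d n) _ _).symm
    rw [← comp_connCochain hi hp hex c hc, ← ha]
    ext x
    exact map_sub i _ _

end Connecting

end CE

/-! ### Representations of `gl(m, ℝ)`, tensor fields on `ℝ^m`, and Lie derivatives -/

/-- The space `ℝ^m`. -/
abbrev Eu (m : ℕ) : Type := Fin m → ℝ

/-- `gl(m, ℝ)`, the endomorphisms of `ℝ^m`. -/
abbrev Gl (m : ℕ) : Type := Eu m →L[ℝ] Eu m

/-- The dual `ℝ^{m*}`. -/
abbrev Cov (m : ℕ) : Type := Eu m →L[ℝ] ℝ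

/-- `∧^p ℝ^m`: skewsymmetric contravariant tensors of degree `p`, i.e. alternating `p`-linear
forms on `ℝ^{m*}`. -/
abbrev Lam (m p : ℕ) : Type := Cov m [⋀^Fin p]→L[ℝ] ℝ

/-- A (continuous) representation of the Lie algebra `gl(m, ℝ)` on `V`. -/
class GlRep (m : ℕ) (V : Type) [NormedAddCommGroup V] [NormedSpace ℝ V] where
  act : Gl m →L[ℝ] V →L[ℝ] V
  act_comm : ∀ (A B : Gl m) (v : V), act (A * B - B * A) v = act A (act B v) - act B (act A v)

section Reps

variable {m : ℕ} {V W : Type} [NormedAddCommGroup V] [NormedSpace ℝ V]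
  [NormedAddCommGroup W] [NormedSpace ℝ W]

/-- The dual of the standard representation: `ρ(A) η = - η ∘ A`. -/
instance glRepCov : GlRep m (Cov m) where
  act := -(ContinuousLinearMap.compL ℝ (Eu m) (Eu m) ℝ).flip
  act_comm A B η := by ext x; simp

/-- The representation on `Hom(V, W)`: `ρ(A) h = ρ_W(A) ∘ h - h ∘ ρ_V(A)`. -/
instance glRepHom [GlRep m V] [GlRep m W] : GlRep m (V →L[ℝ] W) where
  act := (ContinuousLinearMap.compL ℝ V W W).comp GlRep.act
    - ((ContinuousLinearMap.compL ℝ V V W).flip).comp GlRep.act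
  act_comm A B h := by
    ext x
    have h1 := GlRep.act_comm A B (h x)
    have h2 := congrArg h (GlRep.act_comm A B x)
    simp only [map_sub, _root_.sub_apply] at h1 h2
    simp only [map_sub, _root_.sub_apply, ContinuousLinearMap.comp_apply,
      ContinuousLinearMap.flip_apply, ContinuousLinearMap.compL_apply]
    rw [sub_sub_sub_comm, h1, h2]
    abel

theorem glRepCov_apply (A : Gl m) (η : Cov m) (x : Eu m) :
    GlRep.act A η x = - η (A x) := rfl

theorem glRepHom_apply [GlRep m V] [GlRep m W] (A : Gl m) (h : V →L[ℝ] W) (v : V) :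
    GlRep.act A h v = GlRep.act A (h v) - h (GlRep.act A v) := rfl

theorem altDer_comm {R L N : Type*} [CommRing R] [AddCommGroup L] [Module R L] [AddCommGroup N]
    [Module R N] (D D' : L →ₗ[R] L) {n : ℕ} (c : L [⋀^Fin n]→ₗ[R] N) :
    altDer D (altDer D' c) - altDer D' (altDer D c) = altDer (D' ∘ₗ D - D ∘ₗ D') c := by
  ext x
  have h : ∀ D D' : L →ₗ[R] L, altDer D (altDer D' c) x
      = ∑ i, c (Function.update x i (D' (D (x i)))) + ∑ i, ∑ j ∈ Finset.univ.erase i,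
        c (Function.update (Function.update x i (D (x i))) j (D' (x j))) := by
    intro D D'
    simp only [altDer_apply]
    rw [← Finset.sum_add_distrib]
    refine Finset.sum_congr rfl fun i _ => ?_
    rw [← Finset.add_sum_erase _ _ (Finset.mem_univ i)]
    congr 1
    · simp only [Function.update_self, Function.update_idem]
    · refine Finset.sum_congr rfl fun j hj => ?_
      rw [Function.update_of_ne (Finset.ne_of_mem_erase hj)]
  have h2 : ∑ i, ∑ j ∈ Finset.univ.erase i,
        c (Function.update (Function.update x i (D (x i))) j (D' (x j)))
      = ∑ i, ∑ j ∈ Finset.univ.erase i,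
        c (Function.update (Function.update x i (D' (x i))) j (D (x j))) := by
    rw [Finset.sum_comm' (t' := Finset.univ) (s' := fun j => Finset.univ.erase j)
      (by intro i j; simp [ne_comm])]
    refine Finset.sum_congr rfl fun j _ => Finset.sum_congr rfl fun i hi => ?_
    rw [Function.update_comm (Finset.ne_of_mem_erase hi)]
  rw [AlternatingMap.sub_apply, h, h, h2, altDer_apply]
  simp only [LinearMap.sub_apply, LinearMap.comp_apply, AlternatingMap.map_update_sub,
    Finset.sum_sub_distrib]
  abel

/-- The canonical action of `gl(m, ℝ)` on `∧^p ℝ^m`, extending the standard one as a derivation: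
`(ρ(A) T)(β₁, …, β_p) = ∑ i, T (β₁, …, βᵢ ∘ A, …, β_p)`. (This is the derivative at the identity
of the action of the linear group, which is how it is bundled here.) -/
def lamAct (m p : ℕ) : Gl m →L[ℝ] Lam m p →L[ℝ] Lam m p :=
  (ContinuousAlternatingMap.fderivCompContinuousLinearMapCLM ℝ
    (ContinuousLinearMap.id ℝ (Cov m))).flip.comp
    (ContinuousLinearMap.compL ℝ (Eu m) (Eu m) ℝ).flip

theorem lamAct_apply {p : ℕ} (A : Gl m) (T : Lam m p) (β : Fin p → Cov m) :
    lamAct m p A T β = ∑ i, T (Function.update β i ((β i).comp A)) := by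
  refine (ContinuousAlternatingMap.fderivCompContinuousLinearMap_apply T _ _ β).trans ?_
  refine Finset.sum_congr rfl fun i _ => congrArg T ?_
  funext j
  rcases eq_or_ne j i with rfl | h
  · simp
  · simp [h]

instance glRepLam (p : ℕ) : GlRep m (Lam m p) where
  act := lamAct m p
  act_comm A B T := by
    let D : Gl m → Cov m →ₗ[ℝ] Cov m := fun A =>
      ((ContinuousLinearMap.compL ℝ (Eu m) (Eu m) ℝ).flip A : Cov m →L[ℝ] Cov m)
    have h : ∀ (A : Gl m) (T : Lam m p),
        (lamAct m p A T).toAlternatingMap = altDer (D A) T.toAlternatingMap := by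
      intro A T
      ext β
      exact lamAct_apply A T β
    apply ContinuousAlternatingMap.toAlternatingMap_injective
    have hs : ∀ T T' : Lam m p, (T - T').toAlternatingMap
      = T.toAlternatingMap - T'.toAlternatingMap := fun _ _ => rfl
    rw [hs, h, h, h, h, h, altDer_comm]
    congr 1
    ext β x
    simp [D]

end Reps

theorem two_le_infty : (2 : WithTop ℕ∞) ≤ ∞ := WithTop.coe_le_coe.2 le_top

section Fields

variable (m : ℕ) (V : Type) [NormedAddCommGroup V] [NormedSpace ℝ V]

/-- The smooth maps `ℝ^m → V`, as a subspace of all maps. -/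
def smoothMaps : Submodule ℝ (Eu m → V) where
  carrier := {f | ContDiff ℝ ∞ f}
  add_mem' {f g} (hf : ContDiff ℝ ∞ f) (hg : ContDiff ℝ ∞ g) := hf.add hg
  zero_mem' := (contDiff_const : ContDiff ℝ ∞ fun _ : Eu m => (0 : V))
  smul_mem' r f (hf : ContDiff ℝ ∞ f) := hf.const_smul r

/-- `C^∞(ℝ^m, V)`. -/
def Sec : Type := smoothMaps m V

instance : AddCommGroup (Sec m V) := inferInstanceAs (AddCommGroup (smoothMaps m V))
instance : Module ℝ (Sec m V) := inferInstanceAs (Module ℝ (smoothMaps m V))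
instance : CoeFun (Sec m V) (fun _ => Eu m → V) := ⟨fun f => f.1⟩

/-- The vector fields on `ℝ^m`. -/
abbrev Vect : Type := Sec m (Eu m)

variable {m V}

/-- A smooth map as an element of `C^∞(ℝ^m, V)`. -/
def Sec.mk (f : Eu m → V) (hf : ContDiff ℝ ∞ f) : Sec m V := ⟨f, hf⟩

namespace Sec

@[ext] theorem ext {f g : Sec m V} (h : ∀ x, f x = g x) : f = g := Subtype.ext (funext h)
@[simp] theorem mk_apply (f : Eu m → V) (hf : ContDiff ℝ ∞ f) (x : Eu m) :
    Sec.mk f hf x = f x := rfl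
@[simp] theorem add_apply (f g : Sec m V) (x : Eu m) : (f + g) x = f x + g x := rfl
@[simp] theorem sub_apply (f g : Sec m V) (x : Eu m) : (f - g) x = f x - g x := rfl
@[simp] theorem neg_apply (f : Sec m V) (x : Eu m) : (-f) x = - f x := rfl
@[simp] theorem zero_apply (x : Eu m) : (0 : Sec m V) x = 0 := rfl
@[simp] theorem smul_apply (r : ℝ) (f : Sec m V) (x : Eu m) : (r • f) x = r • f x := rfl

theorem smooth (f : Sec m V) : ContDiff ℝ ∞ f.1 := f.2
theorem diff (f : Sec m V) : Differentiable ℝ f.1 := f.smooth.differentiable (by simp)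
theorem smooth_fderiv (f : Sec m V) : ContDiff ℝ ∞ (fderiv ℝ f.1) :=
  f.smooth.fderiv_right (by simp)
theorem diff_fderiv (f : Sec m V) : Differentiable ℝ (fderiv ℝ f.1) :=
  f.smooth_fderiv.differentiable (by simp)

theorem fderiv_add (f g : Sec m V) (x : Eu m) :
    fderiv ℝ (f + g).1 x = fderiv ℝ f.1 x + fderiv ℝ g.1 x :=
  _root_.fderiv_add (f.diff x) (g.diff x)

theorem fderiv_smul (r : ℝ) (f : Sec m V) (x : Eu m) :
    fderiv ℝ (r • f).1 x = r • fderiv ℝ f.1 x :=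
  fderiv_const_smul (f.diff x) r

theorem fderiv_symm (f : Sec m V) (x v w : Eu m) :
    fderiv ℝ (fderiv ℝ f.1) x v w = fderiv ℝ (fderiv ℝ f.1) x w v :=
  (f.smooth.contDiffAt.isSymmSndFDerivAt (by simpa using two_le_infty)) v w

end Sec

/-- The Lie algebra structure of `Vect(ℝ^m)`: `[X, Y](x) = DY(x) X(x) - DX(x) Y(x)`. -/
instance : LieRing (Vect m) where
  bracket X Y := Sec.mk (VectorField.lieBracket ℝ X.1 Y.1)
    (X.smooth.lieBracket_vectorField Y.smooth (by simp))
  add_lie X Y Z := Sec.ext fun x =>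
    VectorField.lieBracket_add_left (X.diff x) (Y.diff x)
  lie_add X Y Z := Sec.ext fun x =>
    VectorField.lieBracket_add_right (Y.diff x) (Z.diff x)
  lie_self X := Sec.ext fun x => congrFun VectorField.lieBracket_self x
  leibniz_lie X Y Z := Sec.ext fun x =>
    VectorField.leibniz_identity_lieBracket (n := ∞) (by simpa using two_le_infty) X.smooth.contDiffAt
      Y.smooth.contDiffAt Z.smooth.contDiffAt

theorem Vect.lie_apply (X Y : Vect m) (x : Eu m) :
    (⁅X, Y⁆ : Vect m) x = fderiv ℝ Y.1 x (X x) - fderiv ℝ X.1 x (Y x) := rfl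

instance : LieAlgebra ℝ (Vect m) where
  lie_smul _ _ Y := Sec.ext fun x => VectorField.lieBracket_const_smul_right (Y.diff x)

theorem Vect.fderiv_lie (X Y : Vect m) (x : Eu m) :
    fderiv ℝ (⁅X, Y⁆ : Vect m).1 x = fderiv ℝ (fderiv ℝ Y.1) x (X x)
      - fderiv ℝ (fderiv ℝ X.1) x (Y x)
      - (fderiv ℝ X.1 x * fderiv ℝ Y.1 x - fderiv ℝ Y.1 x * fderiv ℝ X.1 x) := by
  have h := ((Y.diff_fderiv x).hasFDerivAt.clm_apply (X.diff x).hasFDerivAt).sub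
    ((X.diff_fderiv x).hasFDerivAt.clm_apply (Y.diff x).hasFDerivAt)
  have h' : fderiv ℝ (⁅X, Y⁆ : Vect m).1 x = _ := h.fderiv
  rw [h']
  ext1 v
  simp only [_root_.sub_apply, _root_.add_apply,
    ContinuousLinearMap.comp_apply, ContinuousLinearMap.flip_apply, ContinuousLinearMap.mul_def,
    Y.fderiv_symm x v, X.fderiv_symm x v]
  abel

section LieDer

variable [GlRep m V]

theorem Sec.hasFDerivAt_act (X : Vect m) (f : Sec m V) (x : Eu m) :
    HasFDerivAt (fun y => GlRep.act (fderiv ℝ X.1 y) (f y))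
      ((GlRep.act (fderiv ℝ X.1 x)).comp (fderiv ℝ f.1 x)
        + ((GlRep.act (m := m) (V := V)).comp (fderiv ℝ (fderiv ℝ X.1) x)).flip (f x)) x :=
  ((GlRep.act (m := m) (V := V)).hasFDerivAt.comp x (X.diff_fderiv x).hasFDerivAt).clm_apply
    (f.diff x).hasFDerivAt

/-- The Lie derivative `L_X f = X.f - ρ(DX) f` on `C^∞(ℝ^m, V)`. -/
def lieDer (X : Vect m) (f : Sec m V) : Sec m V :=
  Sec.mk (fun x => fderiv ℝ f.1 x (X x) - GlRep.act (fderiv ℝ X.1 x) (f x))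
    ((f.smooth_fderiv.clm_apply X.smooth).sub
      (((GlRep.act (m := m) (V := V)).contDiff.comp X.smooth_fderiv).clm_apply f.smooth))

theorem lieDer_apply (X : Vect m) (f : Sec m V) (x : Eu m) :
    lieDer X f x = fderiv ℝ f.1 x (X x) - GlRep.act (fderiv ℝ X.1 x) (f x) := rfl

theorem fderiv_lieDer (X : Vect m) (f : Sec m V) (x v : Eu m) :
    fderiv ℝ (lieDer X f).1 x v = fderiv ℝ (fderiv ℝ f.1) x v (X x)
      + fderiv ℝ f.1 x (fderiv ℝ X.1 x v)
      - (GlRep.act (fderiv ℝ X.1 x) (fderiv ℝ f.1 x v)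
        + GlRep.act (fderiv ℝ (fderiv ℝ X.1) x v) (f x)) := by
  have h := ((f.diff_fderiv x).hasFDerivAt.clm_apply (X.diff x).hasFDerivAt).sub
    (Sec.hasFDerivAt_act X f x)
  have h' : fderiv ℝ (lieDer X f).1 x = _ := h.fderiv
  rw [h']
  simp only [_root_.sub_apply, _root_.add_apply,
    ContinuousLinearMap.comp_apply, ContinuousLinearMap.flip_apply]
  abel

instance : LieRingModule (Vect m) (Sec m V) where
  bracket := lieDer
  add_lie X Y f := by
    ext x
    simp only [lieDer_apply, Sec.add_apply, Sec.fderiv_add, map_add,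
      _root_.add_apply]
    abel
  lie_add X f g := by
    ext x
    simp only [lieDer_apply, Sec.add_apply, Sec.fderiv_add, map_add,
      _root_.add_apply]
    abel
  leibniz_lie X Y f := by
    ext x
    change lieDer X (lieDer Y f) x = (lieDer ⁅X, Y⁆ f + lieDer Y (lieDer X f)) x
    have hc := GlRep.act_comm (fderiv ℝ X.1 x) (fderiv ℝ Y.1 x) (f x)
    rw [Sec.add_apply, lieDer_apply X, fderiv_lieDer, lieDer_apply Y (lieDer X f), fderiv_lieDer,
      lieDer_apply ⁅X, Y⁆, Vect.lie_apply, Vect.fderiv_lie, lieDer_apply, lieDer_apply,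
      f.fderiv_symm x (Y x) (X x), map_sub GlRep.act, _root_.sub_apply, hc]
    simp only [map_sub, _root_.sub_apply]
    abel

theorem Sec.lie_apply (X : Vect m) (f : Sec m V) (x : Eu m) :
    (⁅X, f⁆ : Sec m V) x = fderiv ℝ f.1 x (X x) - GlRep.act (fderiv ℝ X.1 x) (f x) := rfl

instance : LieModule ℝ (Vect m) (Sec m V) where
  smul_lie r X f := by
    ext x
    simp only [Sec.lie_apply, Sec.smul_apply, Sec.fderiv_smul, map_smul, smul_sub,
      _root_.smul_apply]
  lie_smul r X f := by
    ext x
    simp only [Sec.lie_apply, Sec.smul_apply, Sec.fderiv_smul, map_smul, smul_sub,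
      _root_.smul_apply]

end LieDer

end Fields

/-! ### The algebra `sl_{m+1}` of projective vector fields -/

section Projective

variable {m : ℕ}

/-- The constant vector field `h^* = - h^i ∂_i`. -/
def hField (h : Eu m) : Vect m := Sec.mk (fun _ => -h) contDiff_const

/-- The linear vector field `A^* = - A^i_j x^j ∂_i`. -/
def AField (A : Gl m) : Vect m := Sec.mk (fun x => -(A x)) A.contDiff.neg

/-- The quadratic vector field `α^* = α(x) x^i ∂_i`. -/
def αField (α : Cov m) : Vect m := Sec.mk (fun x => α x • x) (α.contDiff.smul contDiff_id)

theorem fderiv_projField (h : Eu m) (A : Gl m) (α : Cov m) (x v : Eu m) :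
    fderiv ℝ (hField h + AField A + αField α).1 x v = -(A v) + (α v • x + α x • v) := by
  have h1 := (((hasFDerivAt_const (-h) x).add (A.hasFDerivAt (x := x)).neg).add
    ((α.hasFDerivAt (x := x)).smul (hasFDerivAt_id x)))
  have h2 : fderiv ℝ (hField h + AField A + αField α).1 x = _ := h1.fderiv
  rw [h2]
  simp [add_comm]

variable (m)

/-- The realization `sl_{m+1}` of `sl(m+1, ℝ) = ℝ^m ⊕ gl(m, ℝ) ⊕ ℝ^{m*}` as a Lie subalgebra of
`Vect(ℝ^m)`: the vector fields `h^* + A^* + α^*`. -/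
def slProj : LieSubalgebra ℝ (Vect m) where
  carrier := {X | ∃ (h : Eu m) (A : Gl m) (α : Cov m), X = hField h + AField A + αField α}
  add_mem' := by
    rintro _ _ ⟨h, A, α, rfl⟩ ⟨h', A', α', rfl⟩
    refine ⟨h + h', A + A', α + α', Sec.ext fun x => ?_⟩
    simp only [hField, AField, αField, Sec.add_apply, Sec.mk_apply, _root_.add_apply, add_smul]
    abel
  zero_mem' := ⟨0, 0, 0, Sec.ext fun x => by simp [hField, AField, αField]⟩
  smul_mem' := by
    rintro r _ ⟨h, A, α, rfl⟩
    refine ⟨r • h, r • A, r • α, Sec.ext fun x => ?_⟩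
    simp [hField, AField, αField, mul_smul]
  lie_mem' := by
    rintro _ _ ⟨h, A, α, rfl⟩ ⟨h', A', α', rfl⟩
    refine ⟨A h' - A' h, A * A' - A' * A
        + (α' h • ContinuousLinearMap.id ℝ (Eu m) + α'.smulRight h)
        - (α h' • ContinuousLinearMap.id ℝ (Eu m) + α.smulRight h'),
      α.comp A' - α'.comp A, Sec.ext fun x => ?_⟩
    rw [Vect.lie_apply, fderiv_projField, fderiv_projField]
    simp only [hField, AField, αField, Sec.add_apply, Sec.mk_apply, map_add, map_neg, map_smul,
      _root_.add_apply, _root_.sub_apply, _root_.smul_apply, ContinuousLinearMap.comp_apply,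
      ContinuousLinearMap.mul_def, ContinuousLinearMap.smulRight_apply,
      ContinuousLinearMap.id_apply, smul_eq_mul]
    module

end Projective

/-! ### Differential operators of order at most one and their symbols -/

section DiffOp

variable {m : ℕ} {V W : Type} [NormedAddCommGroup V] [NormedSpace ℝ V]
  [NormedAddCommGroup W] [NormedSpace ℝ W]

/-- The `i`-th vector of the canonical basis of `ℝ^m`. -/
abbrev ebasis (i : Fin m) : Eu m := Pi.single i 1

/-- The coordinate form `dx^i`. -/
abbrev dx (i : Fin m) : Cov m := ContinuousLinearMap.proj i

theorem Eu.eq_sum (v : Eu m) : v = ∑ i, dx i v • ebasis i := by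
  ext j
  simp [Finset.sum_apply, Pi.single_apply]

theorem Cov.eq_sum (η : Cov m) : η = ∑ i, η (ebasis i) • dx i := by
  ext v
  conv_lhs => rw [Eu.eq_sum v]
  simp [mul_comm]

theorem sum_transpose {F : Type} [AddCommGroup F] [Module ℝ F] (b : Cov m →ₗ[ℝ] Eu m →ₗ[ℝ] F)
    (A : Gl m) :
    ∑ i, b (dx i) (A (ebasis i)) = ∑ i, b ((dx i).comp A) (ebasis i) := by
  have h1 : ∀ i, b (dx i) (A (ebasis i)) = ∑ j, dx j (A (ebasis i)) • b (dx i) (ebasis j) := by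
    intro i
    conv_lhs => rw [Eu.eq_sum (A (ebasis i))]
    simp only [map_sum, map_smul]
  have h2 : ∀ i, b ((dx i).comp A) (ebasis i)
      = ∑ j, dx i (A (ebasis j)) • b (dx j) (ebasis i) := by
    intro i
    conv_lhs => rw [Cov.eq_sum ((dx i).comp A)]
    simp only [map_sum, map_smul, LinearMap.sum_apply, LinearMap.smul_apply,
      ContinuousLinearMap.comp_apply]
  simp only [h1, h2]
  exact Finset.sum_comm

/-- The operator `f ↦ a(f) + ∑ i, s(dx^i)(∂_i f)`. -/
def op (a : Sec m (V →L[ℝ] W)) (s : Sec m (Cov m →L[ℝ] V →L[ℝ] W)) :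
    Sec m V →ₗ[ℝ] Sec m W where
  toFun f := Sec.mk
    (fun x => a x (f x) + ∑ i, s x (dx i) (fderiv ℝ f.1 x (ebasis i)))
    ((a.smooth.clm_apply f.smooth).add (ContDiff.sum fun i _ =>
      (s.smooth.clm_apply contDiff_const).clm_apply (f.smooth_fderiv.clm_apply contDiff_const)))
  map_add' f g := by
    ext x
    simp only [Sec.mk_apply, Sec.add_apply, Sec.fderiv_add, map_add, _root_.add_apply,
      Finset.sum_add_distrib]
    abel
  map_smul' r f := by
    ext x
    simp only [Sec.mk_apply, Sec.smul_apply, Sec.fderiv_smul, map_smul, _root_.smul_apply,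
      ← Finset.smul_sum, ← smul_add, RingHom.id_apply]

theorem op_apply (a : Sec m (V →L[ℝ] W)) (s : Sec m (Cov m →L[ℝ] V →L[ℝ] W)) (f : Sec m V)
    (x : Eu m) :
    op a s f x = a x (f x) + ∑ i, s x (dx i) (fderiv ℝ f.1 x (ebasis i)) := rfl

theorem op_add (a a' : Sec m (V →L[ℝ] W)) (s s' : Sec m (Cov m →L[ℝ] V →L[ℝ] W)) :
    op (a + a') (s + s') = op a s + op a' s' := by
  ext f x
  simp only [LinearMap.add_apply, op_apply, Sec.add_apply, _root_.add_apply,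
    Finset.sum_add_distrib]
  abel

theorem op_smul (r : ℝ) (a : Sec m (V →L[ℝ] W)) (s : Sec m (Cov m →L[ℝ] V →L[ℝ] W)) :
    op (r • a) (r • s) = r • op a s := by
  ext f x
  simp only [LinearMap.smul_apply, op_apply, Sec.smul_apply, _root_.smul_apply, ← Finset.smul_sum,
    ← smul_add]

theorem op_zero : op (0 : Sec m (V →L[ℝ] W)) 0 = 0 := by
  ext f x
  simp [op_apply]

theorem op_inj {a a' : Sec m (V →L[ℝ] W)} {s s' : Sec m (Cov m →L[ℝ] V →L[ℝ] W)}
    (h : op a s = op a' s') : a = a' ∧ s = s' := by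
  have h1 : ∀ x v, a x v = a' x v := by
    intro x v
    have hd : fderiv ℝ (Sec.mk (fun _ : Eu m => v) contDiff_const).1 x = 0 :=
      (hasFDerivAt_const v x).fderiv
    have := congrArg (fun f : Sec m W => f x)
      (LinearMap.congr_fun h (Sec.mk (fun _ => v) contDiff_const))
    simp only [op_apply, hd] at this
    simpa using this
  have h2 : ∀ x i v, s x (dx i) v = s' x (dx i) v := by
    intro x i v
    have hd : fderiv ℝ (Sec.mk (fun y : Eu m => dx i y • v)
        ((dx i).contDiff.smul contDiff_const)).1 x = (dx i).smulRight v :=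
      ((dx i).hasFDerivAt.smul_const v).fderiv
    have := congrArg (fun f : Sec m W => f x)
      (LinearMap.congr_fun h (Sec.mk (fun y => dx i y • v) ((dx i).contDiff.smul contDiff_const)))
    simp only [op_apply, h1, hd, add_right_inj] at this
    simpa [Pi.single_apply, apply_ite] using this
  refine ⟨Sec.ext fun x => ContinuousLinearMap.ext (h1 x), Sec.ext fun x => ?_⟩
  ext η v
  rw [Cov.eq_sum η]
  simp only [map_sum, map_smul, _root_.sum_apply, _root_.smul_apply, h2]

variable [GlRep m V] [GlRep m W]

/-- The zeroth-order term produced by the second derivative of `X`. -/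
def opCorr (X : Vect m) (s : Sec m (Cov m →L[ℝ] V →L[ℝ] W)) : Sec m (V →L[ℝ] W) :=
  Sec.mk (fun x => ∑ i, (s x (dx i)).comp (GlRep.act (fderiv ℝ (fderiv ℝ X.1) x (ebasis i))))
    (ContDiff.sum fun i _ => (s.smooth.clm_apply contDiff_const).clm_comp
      ((GlRep.act (m := m) (V := V)).contDiff.comp
        ((X.smooth_fderiv.fderiv_right (by simp)).clm_apply contDiff_const)))

/-- The Lie derivative of a differential operator of order one. -/
theorem lie_op (X : Vect m) (a : Sec m (V →L[ℝ] W)) (s : Sec m (Cov m →L[ℝ] V →L[ℝ] W)) :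
    ⁅X, op a s⁆ = op (⁅X, a⁆ + opCorr X s) ⁅X, s⁆ := by
  ext f x
  rw [LieHom.lie_apply, Sec.sub_apply, Sec.lie_apply, op_apply, op_apply, op_apply]
  have hd : fderiv ℝ (op a s f).1 x (X x) = fderiv ℝ a.1 x (X x) (f x)
      + a x (fderiv ℝ f.1 x (X x))
      + ∑ i, (fderiv ℝ s.1 x (X x) (dx i) (fderiv ℝ f.1 x (ebasis i))
        + s x (dx i) (fderiv ℝ (fderiv ℝ f.1) x (X x) (ebasis i))) := by
    have h1 := (a.diff x).hasFDerivAt.clm_apply (f.diff x).hasFDerivAt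
    have h2 := fun i : Fin m => ((s.diff x).hasFDerivAt.clm_apply
      (hasFDerivAt_const (dx i) x)).clm_apply
      ((f.diff_fderiv x).hasFDerivAt.clm_apply (hasFDerivAt_const (ebasis i) x))
    have h3 := h1.add (HasFDerivAt.fun_sum (u := Finset.univ) fun i _ => h2 i)
    have h4 : fderiv ℝ (op a s f).1 x = _ := h3.fderiv
    rw [h4]
    simp [_root_.sum_apply, Finset.sum_add_distrib]
    abel
  have hl : ∀ i, fderiv ℝ (⁅X, f⁆ : Sec m V).1 x (ebasis i)
      = fderiv ℝ (fderiv ℝ f.1) x (X x) (ebasis i)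
      + fderiv ℝ f.1 x (fderiv ℝ X.1 x (ebasis i))
      - (GlRep.act (fderiv ℝ X.1 x) (fderiv ℝ f.1 x (ebasis i))
        + GlRep.act (fderiv ℝ (fderiv ℝ X.1) x (ebasis i)) (f x)) := by
    intro i
    rw [← f.fderiv_symm]
    exact fderiv_lieDer X f x (ebasis i)
  have ht := sum_transpose (LinearMap.mk₂ ℝ
    (fun (η : Cov m) (v : Eu m) => s x η (fderiv ℝ f.1 x v))
    (by intros; simp) (by intros; simp) (by intros; simp) (by intros; simp)) (fderiv ℝ X.1 x)
  simp only [LinearMap.mk₂_apply] at ht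
  rw [hd]
  simp only [hl, Sec.lie_apply, Sec.add_apply, opCorr, Sec.mk_apply, glRepHom_apply,
    _root_.sum_apply, _root_.sub_apply, _root_.add_apply, map_add, map_sub, map_sum,
    Finset.sum_add_distrib, Finset.sum_sub_distrib, ContinuousLinearMap.comp_apply, ht]
  have hc : ∀ i, s x (GlRep.act (fderiv ℝ X.1 x) (dx i)) (fderiv ℝ f.1 x (ebasis i))
      = - s x ((dx i).comp (fderiv ℝ X.1 x)) (fderiv ℝ f.1 x (ebasis i)) := by
    intro i
    have : GlRep.act (fderiv ℝ X.1 x) (dx i) = -((dx i).comp (fderiv ℝ X.1 x)) := rfl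
    rw [this, map_neg, _root_.neg_apply]
  simp only [hc, Finset.sum_neg_distrib]
  abel

variable (m V W)

/-- `𝒟⁰`: the differential operators of order zero from `C^∞(ℝ^m, V)` to `C^∞(ℝ^m, W)`,
`f ↦ a(f)`, with the action `L_X T = L_X ∘ T - T ∘ L_X` of `Vect(ℝ^m)`. -/
def DiffOp0 : LieSubmodule ℝ (Vect m) (Sec m V →ₗ[ℝ] Sec m W) where
  carrier := {T | ∃ a : Sec m (V →L[ℝ] W), T = op a 0}
  add_mem' := by
    rintro _ _ ⟨a, rfl⟩ ⟨a', rfl⟩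
    exact ⟨a + a', by rw [← op_add, add_zero]⟩
  zero_mem' := ⟨0, op_zero.symm⟩
  smul_mem' := by
    rintro r _ ⟨a, rfl⟩
    exact ⟨r • a, by rw [← op_smul, smul_zero]⟩
  lie_mem := by
    rintro X _ ⟨a, rfl⟩
    exact ⟨⁅X, a⁆ + opCorr X 0, by rw [lie_op, lie_zero]⟩

/-- `𝒟¹`: the differential operators of order at most one from `C^∞(ℝ^m, V)` to
`C^∞(ℝ^m, W)`, `f ↦ a(f) + ∑ i, sⁱ(∂_i f)` with `sⁱ = s(dx^i)`, with the action
`L_X T = L_X ∘ T - T ∘ L_X` of `Vect(ℝ^m)`. -/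
def DiffOp1 : LieSubmodule ℝ (Vect m) (Sec m V →ₗ[ℝ] Sec m W) where
  carrier := {T | ∃ (s : Sec m (Cov m →L[ℝ] V →L[ℝ] W)) (a : Sec m (V →L[ℝ] W)), T = op a s}
  add_mem' := by
    rintro _ _ ⟨s, a, rfl⟩ ⟨s', a', rfl⟩
    exact ⟨s + s', a + a', (op_add _ _ _ _).symm⟩
  zero_mem' := ⟨0, 0, op_zero.symm⟩
  smul_mem' := by
    rintro r _ ⟨s, a, rfl⟩
    exact ⟨r • s, r • a, (op_smul _ _ _).symm⟩
  lie_mem := by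
    rintro X _ ⟨s, a, rfl⟩
    exact ⟨⁅X, s⁆, ⁅X, a⁆ + opCorr X s, lie_op X a s⟩

/-- `𝒮¹`: the symbols of order one, i.e. `ℝ^m ⊗ Hom(V, W)`-valued tensor fields, viewed as smooth
families of `Hom(V, W)`-valued linear functions of `η ∈ ℝ^{m*}`. -/
abbrev Symb1 : Type := Sec m (Cov m →L[ℝ] V →L[ℝ] W)

variable {m V W}

/-- The coefficient `s` of an operator of order at most one is its principal symbol. -/
theorem exists_symbol (T : DiffOp1 m V W) :
    ∃! s : Symb1 m V W, ∃ a : Sec m (V →L[ℝ] W), T.1 = op a s := by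
  obtain ⟨s, a, h⟩ := T.2
  exact ⟨s, ⟨a, h⟩, fun s' ⟨a', h'⟩ => (op_inj (h'.symm.trans h)).2⟩

/-- The principal symbol, as a map. -/
def symbolFun (T : DiffOp1 m V W) : Symb1 m V W := (exists_symbol T).choose

theorem symbolFun_eq {T : DiffOp1 m V W} {s : Symb1 m V W} {a : Sec m (V →L[ℝ] W)}
    (h : T.1 = op a s) : symbolFun T = s :=
  ((exists_symbol T).choose_spec.2 s ⟨a, h⟩).symm

variable (g : LieSubalgebra ℝ (Vect m)) (V W)

/-- The inclusion `𝒟⁰ → 𝒟¹`, as a map of `g`-modules. -/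
def inclD : DiffOp0 m V W →ₗ⁅ℝ, g⁆ DiffOp1 m V W where
  toFun T := ⟨T.1, by obtain ⟨a, h⟩ := T.2; exact ⟨0, a, h⟩⟩
  map_add' _ _ := rfl
  map_smul' _ _ := rfl
  map_lie' := rfl

/-- The principal symbol `σ : 𝒟¹ → 𝒮¹`, as a map of `g`-modules. -/
def symbolD : DiffOp1 m V W →ₗ⁅ℝ, g⁆ Symb1 m V W where
  toFun := symbolFun
  map_add' T T' := by
    obtain ⟨s, a, h⟩ := T.2
    obtain ⟨s', a', h'⟩ := T'.2
    rw [symbolFun_eq h, symbolFun_eq h']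
    refine symbolFun_eq (a := a + a') ?_
    rw [op_add, ← h, ← h']
    rfl
  map_smul' r T := by
    obtain ⟨s, a, h⟩ := T.2
    rw [symbolFun_eq h]
    refine symbolFun_eq (a := r • a) ?_
    rw [RingHom.id_apply, op_smul, ← h]
    rfl
  map_lie' {X T} := by
    obtain ⟨s, a, h⟩ := T.2
    rw [symbolFun_eq h]
    refine symbolFun_eq (a := ⁅X.1, a⁆ + opCorr X.1 s) ?_
    change _ = op _ ⁅X.1, s⁆
    rw [← lie_op, ← h]
    rfl

variable {V W}

theorem symbolD_eq {T : DiffOp1 m V W} {s : Symb1 m V W} {a : Sec m (V →L[ℝ] W)}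
    (h : T.1 = op a s) : symbolD V W g T = s := symbolFun_eq h

variable (V W)

theorem inclD_injective : Function.Injective (inclD V W g) := fun _ _ h =>
  Subtype.ext (congrArg (fun T : DiffOp1 m V W => T.1) h)

theorem symbolD_surjective : Function.Surjective (symbolD V W g) := fun s =>
  ⟨⟨op 0 s, s, 0, rfl⟩, symbolD_eq g rfl⟩

theorem exact_inclD_symbolD : Function.Exact (inclD V W g) (symbolD V W g) := by
  intro T
  obtain ⟨s, a, h⟩ := T.2
  rw [symbolD_eq g h]
  constructor
  · rintro rfl
    exact ⟨⟨T.1, a, h⟩, rfl⟩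
  · rintro ⟨T', h'⟩
    obtain ⟨a', ha'⟩ := T'.2
    have h1 : T'.1 = T.1 := congrArg (fun T : DiffOp1 m V W => T.1) h'
    exact (op_inj (h.symm.trans (h1.symm.trans ha'))).2

/-- The connecting homomorphism `θ : Hⁿ(g, 𝒮¹) → Hⁿ⁺¹(g, 𝒟⁰)` of the short exact sequence
`0 → 𝒟⁰ → 𝒟¹ → 𝒮¹ → 0` of `g`-modules. -/
def θ (n : ℕ) : CE.H ℝ g (Symb1 m V W) n →ₗ[ℝ] CE.H ℝ g (DiffOp0 m V W) (n + 1) :=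
  CE.connecting (inclD_injective V W g) (symbolD_surjective V W g) (exact_inclD_symbolD V W g) n

variable {V W}

/-- The operator of order zero with a given coefficient: the identification of
`𝒮⁰ = C^∞(ℝ^m, Hom(V, W))` with `𝒟⁰`. -/
def mulOp : Sec m (V →L[ℝ] W) →ₗ[ℝ] DiffOp0 m V W where
  toFun a := ⟨op a 0, a, rfl⟩
  map_add' a a' := Subtype.ext (by simpa using op_add a a' 0 0)
  map_smul' r a := Subtype.ext (by simpa using op_smul r a 0)

theorem mulOp_apply (a : Sec m (V →L[ℝ] W)) (f : Sec m V) (x : Eu m) :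
    (mulOp a).1 f x = a x (f x) := by
  change op a 0 f x = _
  simp [op_apply]

end DiffOp

/-! ### The map `χ` -/

section Chi

variable {m : ℕ} {V : Type} [NormedAddCommGroup V] [NormedSpace ℝ V]

/-- The trace on `gl(m, ℝ)`. -/
def traceGl (m : ℕ) : Gl m →L[ℝ] ℝ :=
  LinearMap.toContinuousLinearMap
    ((LinearMap.trace ℝ (Eu m)).comp (ContinuousLinearMap.coeLM ℝ))

theorem traceGl_apply (A : Gl m) : traceGl m A = LinearMap.trace ℝ (Eu m) (A : Eu m →ₗ[ℝ] Eu m) :=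
  rfl

/-- The Jacobian `DX` of a vector field. -/
def jac : Vect m →ₗ[ℝ] Sec m (Gl m) where
  toFun X := Sec.mk (fderiv ℝ X.1) X.smooth_fderiv
  map_add' X Y := Sec.ext fun x => Sec.fderiv_add X Y x
  map_smul' r X := Sec.ext fun x => Sec.fderiv_smul r X x

theorem jac_apply (X : Vect m) (x : Eu m) : jac X x = fderiv ℝ X.1 x := rfl

/-- The differential `d tr(DX)` of the divergence of a vector field. -/
def dtr : Vect m →ₗ[ℝ] Sec m (Cov m) where
  toFun X := Sec.mk (fderiv ℝ fun x => traceGl m (jac X x))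
    (((traceGl m).contDiff.comp (jac X).smooth).fderiv_right (by simp))
  map_add' X Y := Sec.ext fun x => by
    have h : ∀ Z : Vect m, DifferentiableAt ℝ (fun x => traceGl m (jac Z x)) x := fun Z =>
      ((traceGl m).differentiableAt).comp x ((jac Z).diff x)
    have := _root_.fderiv_add (h X) (h Y)
    simp only [Sec.mk_apply, Sec.add_apply, map_add]
    exact this
  map_smul' r X := Sec.ext fun x => by
    have h : ∀ Z : Vect m, DifferentiableAt ℝ (fun x => traceGl m (jac Z x)) x := fun Z =>
      ((traceGl m).differentiableAt).comp x ((jac Z).diff x)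
    have := fderiv_const_smul (h X) r
    simp only [Sec.mk_apply, Sec.smul_apply, map_smul, RingHom.id_apply]
    exact this

theorem dtr_apply (X : Vect m) (x : Eu m) :
    dtr X x = fderiv ℝ (fun y => traceGl m (fderiv ℝ X.1 y)) x := rfl

variable {t u : ℕ}

theorem contDiff_alt_apply {E F : Type} [NormedAddCommGroup E] [NormedSpace ℝ E]
    [NormedAddCommGroup F] [NormedSpace ℝ F] {n : ℕ} {G : E → F [⋀^Fin n]→L[ℝ] V}
    (hG : ContDiff ℝ ∞ G) {v : Fin n → E → F} (hv : ∀ i, ContDiff ℝ ∞ (v i)) :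
    ContDiff ℝ ∞ (fun x => G x (fun i => v i x)) := by
  induction n with
  | zero =>
    have h := (ContinuousAlternatingMap.constOfIsEmptyLIE ℝ F V (Fin 0)).symm.contDiff.comp hG
    convert h using 1
    funext x
    change _ = G x _
    exact congrArg _ (Subsingleton.elim _ _)
  | succ n ih =>
    have h := ((ContinuousAlternatingMap.curryLeftLI
      (𝕜 := ℝ) (E := F) (F := V) (n := n)).toContinuousLinearMap.contDiff.comp hG).clm_apply (hv 0)
    convert ih h (v := fun i => v i.succ) fun i => hv i.succ using 1
    funext x
    change G x _ = G x _
    congr 1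
    funext i
    induction i using Fin.cases <;> rfl

theorem update_jac (X : Fin (t + u) → Vect m) (i : Fin t) (Y : Vect m) (x : Eu m) :
    (fun k => jac (Function.update X (Fin.castAdd u i) Y (Fin.castAdd u k)) x)
        = Function.update (fun k => jac (X (Fin.castAdd u k)) x) i (jac Y x)
      ∧ (fun k => dtr (Function.update X (Fin.castAdd u i) Y (Fin.natAdd t k)) x)
        = fun k => dtr (X (Fin.natAdd t k)) x := by
  constructor <;> funext k
  · rcases eq_or_ne k i with rfl | h
    · simp
    · rw [Function.update_of_ne (fun e => h (Fin.castAdd_injective _ _ e)),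
        Function.update_of_ne h]
  · rw [Function.update_of_ne]
    exact fun e => by
      have := congrArg Fin.val e
      simp at this
      omega

theorem update_dtr (X : Fin (t + u) → Vect m) (i : Fin u) (Y : Vect m) (x : Eu m) :
    (fun k => dtr (Function.update X (Fin.natAdd t i) Y (Fin.natAdd t k)) x)
        = Function.update (fun k => dtr (X (Fin.natAdd t k)) x) i (dtr Y x)
      ∧ (fun k => jac (Function.update X (Fin.natAdd t i) Y (Fin.castAdd u k)) x)
        = fun k => jac (X (Fin.castAdd u k)) x := by
  constructor <;> funext k
  · rcases eq_or_ne k i with rfl | h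
    · simp
    · rw [Function.update_of_ne (fun e => h (Fin.natAdd_injective _ _ e)),
        Function.update_of_ne h]
  · rw [Function.update_of_ne]
    exact fun e => by
      have := congrArg Fin.val e
      simp at this
      omega

/-- The multilinear map
`(X₀, …, X_{t+u-1}) ↦ c(DX₀, …, DX_{t-1})(d tr DX_t, …, d tr DX_{t+u-1})`. -/
def chiMul (c : Gl m [⋀^Fin t]→L[ℝ] (Cov m [⋀^Fin u]→L[ℝ] V)) :
    MultilinearMap ℝ (fun _ : Fin (t + u) => Vect m) (Sec m V) where
  toFun X := Sec.mk
    (fun x => c (fun i => jac (X (Fin.castAdd u i)) x) (fun j => dtr (X (Fin.natAdd t j)) x))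
    (contDiff_alt_apply (contDiff_alt_apply contDiff_const fun i => (jac _).smooth)
      fun j => (dtr _).smooth)
  map_update_add' := by
    intro inst X i Y Z
    obtain rfl : inst = instDecidableEqFin (t + u) := Subsingleton.elim _ _
    ext x
    induction i using Fin.addCases with
    | left i =>
      simp only [Sec.mk_apply, Sec.add_apply, (update_jac X i _ x).1, (update_jac X i _ x).2,
        map_add, ContinuousAlternatingMap.map_update_add, ContinuousAlternatingMap.add_apply]
    | right i =>
      simp only [Sec.mk_apply, Sec.add_apply, (update_dtr X i _ x).1, (update_dtr X i _ x).2,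
        map_add, ContinuousAlternatingMap.map_update_add]
  map_update_smul' := by
    intro inst X i r Y
    obtain rfl : inst = instDecidableEqFin (t + u) := Subsingleton.elim _ _
    ext x
    induction i using Fin.addCases with
    | left i =>
      simp only [Sec.mk_apply, Sec.smul_apply, (update_jac X i _ x).1, (update_jac X i _ x).2,
        map_smul, ContinuousAlternatingMap.map_update_smul, ContinuousAlternatingMap.smul_apply]
    | right i =>
      simp only [Sec.mk_apply, Sec.smul_apply, (update_dtr X i _ x).1, (update_dtr X i _ x).2,
        map_smul, ContinuousAlternatingMap.map_update_smul]

/-- The map `χ : ∧^t(gl(m, ℝ), ∧^u(ℝ^{m*}, V)) → ∧^{t+u}(sl_{m+1}, C^∞(ℝ^m, V))`,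
`χ(c)(X₀, …, X_{t+u-1}) = (-1)^t / (t! u! (m+1)^u) *
  ∑ ν, sign(ν) c(DX_{ν 0}, …, DX_{ν(t-1)})(d tr DX_{ν t}, …, d tr DX_{ν(t+u-1)})`. -/
def χ (c : Gl m [⋀^Fin t]→L[ℝ] (Cov m [⋀^Fin u]→L[ℝ] V)) :
    slProj m [⋀^Fin (t + u)]→ₗ[ℝ] Sec m V :=
  ((-1 : ℝ) ^ t / (t.factorial * u.factorial * ((m : ℝ) + 1) ^ u)) •
    (MultilinearMap.alternatization (chiMul c)).compLinearMap (slProj m).toSubmodule.subtype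

theorem χ_apply (c : Gl m [⋀^Fin t]→L[ℝ] (Cov m [⋀^Fin u]→L[ℝ] V)) (X : Fin (t + u) → slProj m)
    (x : Eu m) :
    χ c X x = ((-1 : ℝ) ^ t / (t.factorial * u.factorial * ((m : ℝ) + 1) ^ u)) •
      ∑ ν : Equiv.Perm (Fin (t + u)), (Equiv.Perm.sign ν : ℤ) •
        c (fun i => fderiv ℝ (X (ν (Fin.castAdd u i))).1.1 x)
          (fun j => fderiv ℝ (fun y => traceGl m (fderiv ℝ (X (ν (Fin.natAdd t j))).1.1 y)) x) := by
  rw [χ, AlternatingMap.smul_apply, Sec.smul_apply, AlternatingMap.compLinearMap_apply,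
    MultilinearMap.alternatization_apply]
  congr 1
  have h : ∀ (s : Finset (Equiv.Perm (Fin (t + u)))) (F : Equiv.Perm (Fin (t + u)) → Sec m V),
      (∑ ν ∈ s, F ν) x = ∑ ν ∈ s, F ν x := by
    intro s F
    induction s using Finset.cons_induction with
    | empty => rfl
    | cons a s ha ih => rw [Finset.sum_cons, Finset.sum_cons, Sec.add_apply, ih]
  rw [h]
  refine Finset.sum_congr rfl fun ν _ => ?_
  rcases Int.units_eq_one_or (Equiv.Perm.sign ν) with hν | hν
  · rw [hν, one_smul, Units.val_one, one_smul]
    rfl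
  · rw [hν, Units.neg_smul, one_smul, Units.val_neg, Units.val_one, neg_smul, one_smul]
    rfl

end Chi

/-! ### Invariants and the contractions `I₀`, `I₁` -/

section Invariants

variable (m a : ℕ)

/-- The space `(∧^a gl(m, ℝ)^*)_{g-inv}` of alternating forms on `gl(m, ℝ)` invariant under the
adjoint action. -/
def glInv : Submodule ℝ (Gl m [⋀^Fin a]→L[ℝ] ℝ) where
  carrier := {γ | ∀ (A : Gl m) (B : Fin a → Gl m),
    ∑ i, γ (Function.update B i (A * B i - B i * A)) = 0}
  add_mem' {γ γ'} h h' A B := by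
    simp only [ContinuousAlternatingMap.add_apply, Finset.sum_add_distrib, h A B, h' A B, add_zero]
  zero_mem' A B := by simp
  smul_mem' r γ h A B := by
    simp only [ContinuousAlternatingMap.smul_apply, ← Finset.smul_sum, h A B, smul_zero]

variable {m}

/-- The contraction `i_α : ∧^{p+1} ℝ^m → ∧^p ℝ^m`, `(i_α T)(β₁, …, β_p) = T(α, β₁, …, β_p)`,
as a function of `α`. -/
def contr (p : ℕ) : Cov m →L[ℝ] Lam m (p + 1) →L[ℝ] Lam m p :=
  (ContinuousAlternatingMap.curryLeftLI
    (𝕜 := ℝ) (E := Cov m) (F := ℝ) (n := p)).toContinuousLinearMap.flip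

theorem contr_apply {p : ℕ} (α : Cov m) (T : Lam m (p + 1)) (β : Fin p → Cov m) :
    contr p α T β = T (Matrix.vecCons α β) := rfl

/-- The iterated contraction `i_{α₁} ⋯ i_{α_n} : ∧^{q+n} ℝ^m → ∧^q ℝ^m`. -/
def contrIter (q : ℕ) : (n : ℕ) → (Fin n → Cov m) → (Lam m (q + n) →L[ℝ] Lam m q)
  | 0, _ => ContinuousLinearMap.id ℝ _
  | n + 1, α => (contrIter q n (Fin.init α)).comp (contr (q + n) (α (Fin.last n)))

theorem contrIter_succ (q n : ℕ) (α : Fin (n + 1) → Cov m) :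
    contrIter q (n + 1) α
      = (contrIter q n (Fin.init α)).comp (contr (q + n) (α (Fin.last n))) := rfl

theorem contr_contr_self {p : ℕ} (α : Cov m) (T : Lam m (p + 2)) :
    contr p α (contr (p + 1) α T) = 0 :=
  ContinuousAlternatingMap.curryLeft_same T α

theorem contr_contr {p : ℕ} (α β : Cov m) (T : Lam m (p + 2)) :
    contr p α (contr (p + 1) β T) = - contr p β (contr (p + 1) α T) := by
  have h := contr_contr_self (α + β) T
  simp only [map_add, _root_.add_apply, contr_contr_self, zero_add, add_zero] at h
  exact eq_neg_of_add_eq_zero_left (by rw [← h]; abel)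

theorem contrIter_contr (q n : ℕ) (α : Fin n → Cov m) (i : Fin n) (T : Lam m (q + n + 1)) :
    contrIter q n α (contr (q + n) (α i) T) = 0 := by
  induction n with
  | zero => exact i.elim0
  | succ n ih =>
    rw [contrIter_succ, ContinuousLinearMap.comp_apply]
    induction i using Fin.lastCases with
    | last =>
      have := contr_contr_self (p := q + n) (α (Fin.last n)) T
      exact (congrArg _ this).trans (map_zero _)
    | cast i =>
      have h1 := contr_contr (p := q + n) (α (Fin.last n)) (α i.castSucc) T
      refine (congrArg _ h1).trans ?_
      rw [map_neg, neg_eq_zero]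
      exact ih (Fin.init α) i _

/-- `I₀ ∈ ∧^n(ℝ^{m*}, Hom(∧^{q+n} ℝ^m, ∧^q ℝ^m))`,
`I₀(α₁, …, α_n)(T) = i_{α₁} ⋯ i_{α_n} T`. -/
def I₀ (q n : ℕ) : Cov m [⋀^Fin n]→L[ℝ] (Lam m (q + n) →L[ℝ] Lam m q) where
  toFun := contrIter q n
  map_update_add' := by
    intro inst α i x y
    obtain rfl : inst = instDecidableEqFin n := Subsingleton.elim _ _
    induction n with
    | zero => exact i.elim0
    | succ n ih =>
      simp only [contrIter_succ]
      induction i using Fin.lastCases with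
      | last => simp [Fin.init_update_last]
      | cast i => simp [Fin.init_update_castSucc, ih, (Fin.castSucc_lt_last i).ne']
  map_update_smul' := by
    intro inst α i r x
    obtain rfl : inst = instDecidableEqFin n := Subsingleton.elim _ _
    induction n with
    | zero => exact i.elim0
    | succ n ih =>
      simp only [contrIter_succ]
      induction i using Fin.lastCases with
      | last => simp [Fin.init_update_last]
      | cast i => simp [Fin.init_update_castSucc, ih, (Fin.castSucc_lt_last i).ne']
  map_eq_zero_of_eq' := by
    intro α i j h hij
    change contrIter q n α = 0
    induction n with
    | zero => exact i.elim0
    | succ n ih =>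
      rw [contrIter_succ]
      induction i using Fin.lastCases with
      | last =>
        induction j using Fin.lastCases with
        | last => exact absurd rfl hij
        | cast j =>
          ext1 T
          rw [h]
          exact contrIter_contr q n (Fin.init α) j T
      | cast i =>
        induction j using Fin.lastCases with
        | last =>
          ext1 T
          rw [← h]
          exact contrIter_contr q n (Fin.init α) i T
        | cast j =>
          rw [ih (Fin.init α) i j h (fun e => hij (by rw [e])), ContinuousLinearMap.zero_comp]
  cont := by
    change Continuous (contrIter q n)
    induction n with
    | zero => exact continuous_const
    | succ n ih =>
      refine Continuous.clm_comp (ih.comp ?_) ((contr (q + n)).continuous.comp (continuous_apply _))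
      exact continuous_pi fun i => continuous_apply _

theorem I₀_apply (q n : ℕ) (α : Fin n → Cov m) : I₀ q n α = contrIter q n α := rfl

/-- `I₁ ∈ ∧^r(ℝ^{m*}, ℝ^m ⊗ Hom(∧^{q+r+1} ℝ^m, ∧^q ℝ^m))`,
`I₁(α₁, …, α_r)(η)(T) = i_η i_{α₁} ⋯ i_{α_r} T`. -/
def I₁ (q r : ℕ) : Cov m [⋀^Fin r]→L[ℝ] (Cov m →L[ℝ] Lam m (q + (r + 1)) →L[ℝ] Lam m q) :=
  ((I₀ q (r + 1)).curryLeft).flipAlternating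

theorem I₁_apply (q r : ℕ) (α : Fin r → Cov m) (η : Cov m) :
    I₁ q r α η = contrIter q (r + 1) (Matrix.vecCons η α) := rfl

end Invariants

end

/-!
Lift a first-order symbol to the operator with that symbol and no zeroth-order term. The lift
fails to be equivariant under a vector field `X` by the operator of order zero `opCorr X`, which
depends on the second derivatives of `X` only; hence `θ` maps the class of a cocycle `c` to the
class of `∑ i, (-1)^i opCorr Xᵢ (c (X₀, …, X̂ᵢ, …, X_n))`. For the quadratic fields of `sl_{m+1}` a
contraction identity turns `opCorr X (I₁ (β₁, …, β_r))` into `I₀ (d tr DX, β₁, …, β_r)`. Moving the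
new argument past the `a` arguments of `γ` gives `(-1)^a`, and the normalizations of `χ` for `r` and
`r + 1` arguments differ by the factor `(r + 1) (m + 1)`, with `r + 1 = p - q`.

The cocycle property holds over all vector fields: twice the coboundary is an antisymmetrization of
terms which, for an invariant `γ` and an equivariant `I`, are symmetric in two arguments.
-/

noncomputable section

section Antisymmetrize

variable {L M : Type*} [AddCommGroup M] {n : ℕ}

/-- The signed sum of a function of `n` arguments over all the permutations of its arguments. It is
`MultilinearMap.alternatization` for functions that need not be multilinear. -/
def antisymmetrize (f : (Fin n → L) → M) (x : Fin n → L) : M :=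
  ∑ ν : Equiv.Perm (Fin n), Equiv.Perm.sign ν • f (x ∘ ν)

theorem alternatization_eq_antisymmetrize {K : Type*} [Semiring K] [AddCommMonoid L] [Module K L]
    [Module K M] (μ : MultilinearMap K (fun _ : Fin n => L) M) (x : Fin n → L) :
    MultilinearMap.alternatization μ x = antisymmetrize μ x :=
  MultilinearMap.alternatization_apply μ x

theorem map_antisymmetrize {N E : Type*} [AddCommGroup N] [FunLike E M N] [AddMonoidHomClass E M N]
    (e : E) (f : (Fin n → L) → M) (x : Fin n → L) :
    e (antisymmetrize f x) = antisymmetrize (fun y => e (f y)) x := by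
  simp only [antisymmetrize, map_sum, Units.smul_def, map_zsmul]

theorem antisymmetrize_sum {ι : Type*} [Fintype ι] (f : ι → (Fin n → L) → M) (x : Fin n → L) :
    antisymmetrize (fun y => ∑ i, f i y) x = ∑ i, antisymmetrize (f i) x := by
  simp only [antisymmetrize, Finset.smul_sum]
  exact Finset.sum_comm

theorem antisymmetrize_comp_perm (f : (Fin n → L) → M) (π : Equiv.Perm (Fin n)) (x : Fin n → L) :
    antisymmetrize (fun y => f (y ∘ π)) x = Equiv.Perm.sign π • antisymmetrize f x := by
  rw [antisymmetrize, antisymmetrize, Finset.smul_sum, ← Equiv.sum_comp (Equiv.mulRight π)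
    fun ν => Equiv.Perm.sign π • Equiv.Perm.sign ν • f (x ∘ ν)]
  refine Finset.sum_congr rfl fun ν _ => ?_
  rw [Equiv.coe_mulRight, Equiv.Perm.sign_mul, smul_smul, mul_left_comm, Int.units_mul_self,
    mul_one, Equiv.Perm.coe_mul, Function.comp_assoc]

theorem antisymmetrize_eq_zero_of_comp_swap {f : (Fin n → L) → M} {i j : Fin n} (hij : i ≠ j)
    (hf : ∀ y, f (y ∘ Equiv.swap i j) = f y) (x : Fin n → L) : antisymmetrize f x = 0 := by
  refine Finset.sum_involution (fun ν _ => ν * Equiv.swap i j) (fun ν _ => ?_)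
    (fun ν _ _ h => hij (Equiv.swap_eq_one_iff.1 (mul_eq_left.1 h)))
    (fun _ _ => Finset.mem_univ _) (fun ν _ => Equiv.mul_swap_mul_self i j ν)
  rw [Equiv.Perm.coe_mul, ← Function.comp_assoc, hf, Equiv.Perm.sign_mul, Equiv.Perm.sign_swap hij,
    mul_neg_one, Units.neg_smul, add_neg_cancel]

theorem antisymmetrize_eq_zero_of_symm {F : L → (Fin n → L) → M} (j : Fin n)
    (hF : ∀ Y X, F (X j) (Function.update X j Y) = F Y X) (x : Fin (n + 1) → L) :
    antisymmetrize (fun y => F (y 0) (Fin.tail y)) x = 0 := by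
  refine antisymmetrize_eq_zero_of_comp_swap (Fin.succ_ne_zero j).symm (fun y => ?_) x
  have htail : Fin.tail (y ∘ Equiv.swap 0 j.succ) = Function.update (Fin.tail y) j (y 0) := by
    funext l
    rcases eq_or_ne l j with rfl | hl
    · simp [Fin.tail]
    · simp [Fin.tail, hl, Equiv.swap_apply_of_ne_of_ne (Fin.succ_ne_zero l)]
  rw [htail, Function.comp_apply, Equiv.swap_apply_left]
  exact hF (y 0) (Fin.tail y)

/-- A permutation `ν` of `Fin (n + 1)`, encoded by `ν 0` and the permutation of `Fin n` which it
induces on the other indices, for the expansion of an antisymmetrization along its first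
argument. -/
def permOfImageZero (p : Fin (n + 1) × Equiv.Perm (Fin n)) : Equiv.Perm (Fin (n + 1)) :=
  p.1.cycleRange.symm * Equiv.Perm.decomposeFin.symm (0, p.2)

theorem permOfImageZero_zero (i : Fin (n + 1)) (σ : Equiv.Perm (Fin n)) :
    permOfImageZero (i, σ) 0 = i := by
  simp [permOfImageZero, Equiv.Perm.decomposeFin_symm_apply_zero]

theorem permOfImageZero_succ (i : Fin (n + 1)) (σ : Equiv.Perm (Fin n)) (k : Fin n) :
    permOfImageZero (i, σ) k.succ = i.succAbove (σ k) := by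
  simp [permOfImageZero, Equiv.Perm.decomposeFin_symm_apply_succ]

theorem sign_permOfImageZero (i : Fin (n + 1)) (σ : Equiv.Perm (Fin n)) :
    Equiv.Perm.sign (permOfImageZero (i, σ)) = (-1) ^ (i : ℕ) * Equiv.Perm.sign σ := by
  simp [permOfImageZero, Equiv.Perm.decomposeFin.symm_sign, Fin.sign_cycleRange,
    Equiv.Perm.sign_symm]

theorem permOfImageZero_bijective : Function.Bijective (permOfImageZero (n := n)) := by
  refine (Fintype.bijective_iff_injective_and_card _).2 ⟨?_, ?_⟩
  · rintro ⟨i, σ⟩ ⟨j, τ⟩ h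
    obtain rfl : i = j := by
      rw [← permOfImageZero_zero i σ, h, permOfImageZero_zero]
    refine Prod.ext rfl (Equiv.ext fun k => Fin.succAbove_right_injective (p := i) ?_)
    rw [← permOfImageZero_succ, h, permOfImageZero_succ]
  · simp [Fintype.card_perm, Nat.factorial_succ]

variable {K : Type*} [Ring K] [Module K M]

theorem neg_one_pow_units_smul (k : ℕ) (v : M) : (-1 : ℤˣ) ^ k • v = (-1 : K) ^ k • v := by
  simp [Units.smul_def, ← Int.cast_smul_eq_zsmul K]

variable (K) in
theorem antisymmetrize_succ (F : L → (Fin n → L) → M) (x : Fin (n + 1) → L) :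
    antisymmetrize (fun y => F (y 0) (Fin.tail y)) x
      = ∑ i : Fin (n + 1), (-1 : K) ^ (i : ℕ) • antisymmetrize (F (x i)) (i.removeNth x) := by
  rw [antisymmetrize, ← permOfImageZero_bijective.sum_comp, Fintype.sum_prod_type]
  refine Finset.sum_congr rfl fun i _ => ?_
  rw [← neg_one_pow_units_smul, antisymmetrize, Finset.smul_sum]
  refine Finset.sum_congr rfl fun σ _ => ?_
  have htail : Fin.tail (x ∘ permOfImageZero (i, σ)) = i.removeNth x ∘ σ :=
    funext fun k => congrArg x (permOfImageZero_succ i σ k)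
  rw [sign_permOfImageZero, mul_smul, htail, Function.comp_apply, permOfImageZero_zero]

/-- The sign `(-1) ^ a` is that of moving an argument past the first block, of length `a`. -/
theorem sum_antisymmetrize_removeNth {a r : ℕ} (F : (Fin a → L) → (Fin (r + 1) → L) → M)
    (x : Fin (a + r + 1) → L) :
    ∑ i : Fin (a + r + 1), (-1 : K) ^ (i : ℕ) • antisymmetrize
        (fun y => F (y ∘ Fin.castAdd r) (Matrix.vecCons (x i) (y ∘ Fin.natAdd a))) (i.removeNth x)
      = (-1 : K) ^ a • antisymmetrize (n := a + (r + 1))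
        (fun y => F (y ∘ Fin.castAdd (r + 1)) (y ∘ Fin.natAdd a)) x := by
  let k : Fin (a + r + 1) := ⟨a, by omega⟩
  have hk_castAdd : ∀ i : Fin a, k.cycleRange (Fin.castAdd (r + 1) i) = (Fin.castAdd r i).succ :=
    fun i => Fin.ext (Fin.coe_cycleRange_of_lt (Fin.lt_def.2 i.2))
  have hk_natAdd : ∀ j : Fin r, k.cycleRange (Fin.natAdd a j.succ) = (Fin.natAdd a j).succ :=
    fun j => Fin.cycleRange_of_gt (Fin.lt_def.2 (by simp [k]))
  have hF : ∀ y : Fin (a + r + 1) → L,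
      F (Fin.tail y ∘ Fin.castAdd r) (Matrix.vecCons (y 0) (Fin.tail y ∘ Fin.natAdd a))
        = F ((y ∘ k.cycleRange) ∘ Fin.castAdd (r + 1)) ((y ∘ k.cycleRange) ∘ Fin.natAdd a) := by
    intro y
    congr 1
    · exact funext fun i => congrArg y (hk_castAdd i).symm
    · funext j
      induction j using Fin.cases with
      | zero => exact congrArg y (Fin.cycleRange_self k).symm
      | succ j => exact congrArg y (hk_natAdd j).symm
  rw [← antisymmetrize_succ K fun (z : L) (y : Fin (a + r) → L) =>
    (F (y ∘ Fin.castAdd r) (Matrix.vecCons z (y ∘ Fin.natAdd a)) : M), funext hF,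
    ← neg_one_pow_units_smul (K := K)]
  refine (antisymmetrize_comp_perm (fun y : Fin (a + (r + 1)) → L =>
    F (y ∘ Fin.castAdd (r + 1)) (y ∘ Fin.natAdd a)) k.cycleRange x).trans ?_
  rw [Fin.sign_cycleRange]

theorem neg_one_pow_smul_map_vecCons_removeNth [AddCommGroup L] [Module K L]
    (c : L [⋀^Fin (n + 1)]→ₗ[K] M) (x : Fin (n + 1) → L) (i : Fin (n + 1)) (z : L) :
    (-1 : K) ^ (i : ℕ) • c (Matrix.vecCons z (i.removeNth x)) = c (Function.update x i z) := by
  have h := c.map_perm (Function.update x i z) i.cycleRange.symm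
  have hcons : Function.update x i z ∘ i.cycleRange.symm = Matrix.vecCons z (i.removeNth x) := by
    funext k
    induction k using Fin.cases with
    | zero => simp
    | succ k => simp [Fin.removeNth_apply]
  rw [← hcons, h, Equiv.Perm.sign_symm, Fin.sign_cycleRange, ← neg_one_pow_units_smul, smul_smul,
    Int.units_mul_self, one_smul]

end Antisymmetrize

namespace CE

section Alternatization

variable {K L M : Type*} [Field K] [LieRing L] [LieAlgebra K L]
  [AddCommGroup M] [Module K M] [LieRingModule L M] [LieModule K L M]

/-- A form of the coboundary that is symmetric in the two arguments of a bracket: each of them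
comes once as the argument acting on the cochain. -/
theorem two_smul_d_apply {n : ℕ} (c : L [⋀^Fin n]→ₗ[K] M) (x : Fin (n + 1) → L) :
    (2 : K) • d n c x = ∑ i : Fin (n + 1), (-1 : K) ^ (i : ℕ) •
      (⁅x i, c (i.removeNth x)⁆ + lieCochain (x i) c (i.removeNth x)) := by
  induction n with
  | zero => simp [d_apply, lieCochain_apply, two_smul]
  | succ n ih =>
    obtain ⟨y, x, rfl⟩ : ∃ y x', x = Matrix.vecCons y x' := ⟨_, _, (Fin.cons_self_tail x).symm⟩
    have hd : d (n + 1) c (Matrix.vecCons y x) = lieCochain y c x - d n (c.curryLeft y) x :=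
      congrArg (fun b => b x) (d_curryLeft c y)
    have htail : ∀ i : Fin (n + 1), i.succ.removeNth (Matrix.vecCons y x)
        = Matrix.vecCons y (i.removeNth x) := fun i => by
      funext k
      induction k using Fin.cases with
      | zero => rfl
      | succ k => simp [Fin.removeNth_apply]
    have hlie : ∀ i (w : Fin n → L), lieCochain (x i) c (Matrix.vecCons y w)
        = lieCochain (x i) (c.curryLeft y) w - c (Matrix.vecCons ⁅x i, y⁆ w) := fun i w =>
      congrArg (fun b => b w) (lieCochain_curryLeft (x i) y c)
    have hbracket : ∑ i : Fin (n + 1), (-1 : K) ^ (i : ℕ) •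
        c (Matrix.vecCons ⁅x i, y⁆ (i.removeNth x)) = lieCochain y c x - ⁅y, c x⁆ := by
      simp only [neg_one_pow_smul_map_vecCons_removeNth, lieCochain_apply, ← lie_skew y,
        AlternatingMap.map_update_neg, Finset.sum_neg_distrib]
      abel
    rw [hd, smul_sub, ih]
    refine Eq.trans ?_ (Fin.sum_univ_succ _).symm
    simp only [htail, hlie, AlternatingMap.curryLeft_apply_apply, Matrix.cons_val_succ,
      Matrix.cons_val_zero, Fin.val_zero, pow_zero, one_smul, Fin.removeNth_zero, Fin.val_succ,
      pow_succ, mul_neg_one, neg_smul, Finset.sum_neg_distrib, ← add_sub_assoc, smul_sub,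
      Finset.sum_sub_distrib, hbracket]
    rw [show Fin.tail (Matrix.vecCons y x) = x from rfl, two_smul]
    abel

/-- `⁅z, μ y⁆ + (L_z μ) y`, the summand of `two_smul_d_apply` for a multilinear map `μ`. -/
def lieMul {n : ℕ} (μ : MultilinearMap K (fun _ : Fin n => L) M) (z : L) (y : Fin n → L) : M :=
  (2 : K) • ⁅z, μ y⁆ - ∑ j, μ (Function.update y j ⁅z, y j⁆)

theorem two_smul_d_alternatization {n : ℕ} (μ : MultilinearMap K (fun _ : Fin n => L) M)
    (x : Fin (n + 1) → L) :
    (2 : K) • d n (MultilinearMap.alternatization μ) x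
      = antisymmetrize (fun y => lieMul μ (y 0) (Fin.tail y)) x := by
  rw [two_smul_d_apply, antisymmetrize_succ K (lieMul μ)]
  refine Finset.sum_congr rfl fun i _ => congrArg _ ?_
  generalize i.removeNth x = y, x i = z
  have hbracket : ∀ σ : Equiv.Perm (Fin n),
      ∑ j, μ (Function.update y j ⁅z, y j⁆ ∘ σ)
        = ∑ j, μ (Function.update (y ∘ σ) j ⁅z, (y ∘ σ) j⁆) := fun σ => by
    rw [← Equiv.sum_comp σ]
    exact Finset.sum_congr rfl fun j _ => congrArg μ
      (Function.update_comp_eq_of_injective _ σ.injective _ _)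
  simp only [lieCochain_apply, alternatization_eq_antisymmetrize, antisymmetrize, lieMul, lie_sum,
    ← hbracket, Units.smul_def, lie_zsmul, smul_sub, Finset.sum_sub_distrib]
  rw [Finset.sum_comm]
  simp only [← Finset.smul_sum, smul_comm _ (2 : K)]
  rw [two_smul]
  abel

theorem map_d_alternatization_eq_zero [CharZero K] {N ι : Type*} [AddCommGroup N] [Module K N]
    [Fintype ι] (e : M →ₗ[K] N) {n : ℕ} (μ : MultilinearMap K (fun _ : Fin n => L) M)
    (G : ι → L → (Fin n → L) → N) (s : ι → Fin n)
    (hμ : ∀ Y X, e (lieMul μ Y X) = ∑ i, G i Y X)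
    (hG : ∀ i Y X, G i (X (s i)) (Function.update X (s i) Y) = G i Y X) (x : Fin (n + 1) → L) :
    e (d n (MultilinearMap.alternatization μ) x) = 0 := by
  refine (smul_eq_zero.1 ?_).resolve_left (two_ne_zero (α := K))
  rw [← map_smul, two_smul_d_alternatization, map_antisymmetrize]
  simp only [hμ]
  rw [antisymmetrize_sum]
  exact Finset.sum_eq_zero fun i _ => antisymmetrize_eq_zero_of_symm (s i) (hG i) x

theorem compLinearMap_incl_mem_cocycles (g : LieSubalgebra K L) {n : ℕ} {c : L [⋀^Fin n]→ₗ[K] M}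
    (hc : c ∈ cocycles K L M n) : c.compLinearMap (g.incl : g →ₗ[K] L) ∈ cocycles K g M n := by
  refine LinearMap.mem_ker.2 (AlternatingMap.ext fun x => ?_)
  have h := AlternatingMap.congr_fun (LinearMap.mem_ker.1 hc) fun i => (x i : L)
  refine Eq.trans ?_ h
  rw [d_apply, d_apply]
  refine Finset.sum_congr rfl fun i _ => congrArg _ (congrArg₂ _ rfl ?_)
  refine Finset.sum_congr rfl fun j _ => congrArg c ?_
  exact funext fun k => Function.apply_update (fun _ (z : g) => (z : L)) x j _ _

end Alternatization

end CE

section ChiCocycle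

variable {m : ℕ} {V : Type} [NormedAddCommGroup V] [NormedSpace ℝ V]

/-- Evaluation of sections at a point. -/
def Sec.eval (x : Eu m) : Sec m V →ₗ[ℝ] V where
  toFun f := f x
  map_add' _ _ := rfl
  map_smul' _ _ := rfl

theorem Sec.eval_apply (x : Eu m) (f : Sec m V) : Sec.eval x f = f x := rfl

theorem traceGl_mul_comm (A B : Gl m) : traceGl m (A * B) = traceGl m (B * A) :=
  LinearMap.trace_mul_comm ℝ (A : Eu m →ₗ[ℝ] Eu m) (B : Eu m →ₗ[ℝ] Eu m)

/-- The divergence of a vector field. -/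
def divergence (X : Vect m) : Sec m ℝ :=
  Sec.mk (fun x => traceGl m (fderiv ℝ X.1 x)) ((traceGl m).contDiff.comp X.smooth_fderiv)

theorem fderiv_divergence (X : Vect m) (x : Eu m) : fderiv ℝ (divergence X).1 x = dtr X x := rfl

theorem dtr_apply_eq_traceGl (X : Vect m) (x v : Eu m) :
    dtr X x v = traceGl m (fderiv ℝ (fderiv ℝ X.1) x v) := by
  have h := (traceGl m).hasFDerivAt.comp x (X.diff_fderiv x).hasFDerivAt
  exact congrArg (fun A : Cov m => A v) h.fderiv

theorem divergence_lie (X Y : Vect m) (x : Eu m) :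
    divergence ⁅X, Y⁆ x = dtr Y x (X x) - dtr X x (Y x) := by
  change traceGl m (fderiv ℝ (⁅X, Y⁆ : Vect m).1 x) = _
  rw [Vect.fderiv_lie, map_sub, map_sub, map_sub, traceGl_mul_comm, sub_self, sub_zero,
    dtr_apply_eq_traceGl, dtr_apply_eq_traceGl]

theorem dtr_lie (X Y : Vect m) : dtr ⁅X, Y⁆ = ⁅X, dtr Y⁆ - ⁅Y, dtr X⁆ := by
  ext x v
  have h1 : fderiv ℝ (divergence ⁅X, Y⁆).1 x
      = fderiv ℝ (fun y => dtr Y y (X y) - dtr X y (Y y)) x :=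
    congrArg (fun f => fderiv ℝ f x) (funext (divergence_lie X Y))
  have h2 := (((dtr Y).diff x).hasFDerivAt.clm_apply (X.diff x).hasFDerivAt).sub
    (((dtr X).diff x).hasFDerivAt.clm_apply (Y.diff x).hasFDerivAt)
  have h3 : fderiv ℝ (fun y => dtr Y y (X y) - dtr X y (Y y)) x = _ := h2.fderiv
  have hs : ∀ (Z : Vect m) (w : Eu m), fderiv ℝ (dtr Z).1 x v w = fderiv ℝ (dtr Z).1 x w v :=
    fun Z w => (divergence Z).fderiv_symm x v w
  rw [← fderiv_divergence, h1, h3]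
  simp only [Sec.sub_apply, Sec.lie_apply, _root_.sub_apply, _root_.add_apply,
    ContinuousLinearMap.comp_apply, ContinuousLinearMap.flip_apply, glRepCov_apply, hs]
  abel

theorem Vect.jac_lie (X Y : Vect m) (x : Eu m) :
    jac ⁅X, Y⁆ x = fderiv ℝ (jac Y).1 x (X x) - fderiv ℝ (jac X).1 x (Y x)
      - (jac X x * jac Y x - jac Y x * jac X x) :=
  Vect.fderiv_lie X Y x

variable {t u : ℕ}

theorem chiMul_smulRight_apply (γ : Gl m [⋀^Fin t]→L[ℝ] ℝ) (I : Cov m [⋀^Fin u]→L[ℝ] V)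
    (X : Fin (t + u) → Vect m) (x : Eu m) :
    chiMul (γ.smulRight I) X x = γ (fun i => jac (X (Fin.castAdd u i)) x)
      • I (fun j => dtr (X (Fin.natAdd t j)) x) := rfl

theorem hasFDerivAt_alternating_apply {F : Type} [NormedAddCommGroup F] [NormedSpace ℝ F] {n : ℕ}
    (c : F [⋀^Fin n]→L[ℝ] V) (s : Fin n → Sec m F) (x : Eu m) :
    HasFDerivAt (fun x => c fun i => s i x)
      (∑ i, (c.toContinuousLinearMap (fun i => s i x) i).comp (fderiv ℝ (s i).1 x)) x := by
  have h := (hasFDerivAt_const c x).continuousAlternatingMap_apply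
    fun i => ((s i).diff x).hasFDerivAt
  rwa [ContinuousLinearMap.comp_zero, zero_add] at h

theorem fderiv_chiMul_smulRight (γ : Gl m [⋀^Fin t]→L[ℝ] ℝ) (I : Cov m [⋀^Fin u]→L[ℝ] V)
    (X : Fin (t + u) → Vect m) (x v : Eu m) :
    fderiv ℝ (chiMul (γ.smulRight I) X).1 x v
      = (∑ i, γ (Function.update (fun i => jac (X (Fin.castAdd u i)) x) i
            (fderiv ℝ (jac (X (Fin.castAdd u i))).1 x v)))
          • I (fun j => dtr (X (Fin.natAdd t j)) x)
        + γ (fun i => jac (X (Fin.castAdd u i)) x)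
          • ∑ j, I (Function.update (fun j => dtr (X (Fin.natAdd t j)) x) j
            (fderiv ℝ (dtr (X (Fin.natAdd t j))).1 x v)) := by
  have h : fderiv ℝ (chiMul (γ.smulRight I) X).1 x = _ :=
    ((hasFDerivAt_alternating_apply γ (fun i => jac (X (Fin.castAdd u i))) x).smul
      (hasFDerivAt_alternating_apply I (fun j => dtr (X (Fin.natAdd t j))) x)).fderiv
  rw [h, add_comm]
  simp only [_root_.add_apply, _root_.smul_apply, _root_.sum_apply,
    ContinuousLinearMap.smulRight_apply, ContinuousLinearMap.comp_apply,
    ContinuousAlternatingMap.toContinuousLinearMap_apply]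

/-- The `i`-th term contributed by `γ` to `CE.lieMul (chiMul (γ.smulRight I)) Y X`. -/
def jacTerm (γ : Gl m [⋀^Fin t]→L[ℝ] ℝ) (I : Cov m [⋀^Fin u]→L[ℝ] V) (x : Eu m)
    (i : Fin t) (Y : Vect m) (X : Fin (t + u) → Vect m) : V :=
  γ (Function.update (fun i => jac (X (Fin.castAdd u i)) x) i
      (fderiv ℝ (jac (X (Fin.castAdd u i))).1 x (Y x)
        + fderiv ℝ (jac Y).1 x (X (Fin.castAdd u i) x)))
    • I (fun j => dtr (X (Fin.natAdd t j)) x)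

/-- The `j`-th term contributed by `I` to `CE.lieMul (chiMul (γ.smulRight I)) Y X`. -/
def dtrTerm (γ : Gl m [⋀^Fin t]→L[ℝ] ℝ) (I : Cov m [⋀^Fin u]→L[ℝ] V) (x : Eu m)
    (j : Fin u) (Y : Vect m) (X : Fin (t + u) → Vect m) : V :=
  γ (fun i => jac (X (Fin.castAdd u i)) x)
    • I (Function.update (fun j => dtr (X (Fin.natAdd t j)) x) j
      (⁅Y, dtr (X (Fin.natAdd t j))⁆ x + ⁅X (Fin.natAdd t j), dtr Y⁆ x))

theorem jacTerm_update (γ : Gl m [⋀^Fin t]→L[ℝ] ℝ) (I : Cov m [⋀^Fin u]→L[ℝ] V) (x : Eu m)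
    (i : Fin t) (Y : Vect m) (X : Fin (t + u) → Vect m) :
    jacTerm γ I x i (X (Fin.castAdd u i)) (Function.update X (Fin.castAdd u i) Y)
      = jacTerm γ I x i Y X := by
  rw [jacTerm, jacTerm, (update_jac X i Y x).1, (update_jac X i Y x).2]
  simp only [Function.update_self, Function.update_idem]
  rw [add_comm]

theorem dtrTerm_update (γ : Gl m [⋀^Fin t]→L[ℝ] ℝ) (I : Cov m [⋀^Fin u]→L[ℝ] V) (x : Eu m)
    (j : Fin u) (Y : Vect m) (X : Fin (t + u) → Vect m) :
    dtrTerm γ I x j (X (Fin.natAdd t j)) (Function.update X (Fin.natAdd t j) Y)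
      = dtrTerm γ I x j Y X := by
  rw [dtrTerm, dtrTerm, (update_dtr X j Y x).1, (update_dtr X j Y x).2]
  simp only [Function.update_self, Function.update_idem]
  rw [add_comm]

variable [GlRep m V]

/-- Equivariance under `gl(m, ℝ)`, in infinitesimal form, of an alternating map on `ℝ^{m*}` with
values in a representation. -/
def IsGlEquivariant (I : Cov m [⋀^Fin u]→L[ℝ] V) : Prop :=
  ∀ (A : Gl m) (α : Fin u → Cov m),
    GlRep.act A (I α) = ∑ j, I (Function.update α j (GlRep.act A (α j)))

theorem lieMul_chiMul {γ : Gl m [⋀^Fin t]→L[ℝ] ℝ} (hγ : γ ∈ glInv m t)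
    {I : Cov m [⋀^Fin u]→L[ℝ] V} (hI : IsGlEquivariant I) (Y : Vect m) (X : Fin (t + u) → Vect m)
    (x : Eu m) :
    CE.lieMul (chiMul (γ.smulRight I)) Y X x
      = ∑ i, jacTerm γ I x i Y X + ∑ j, dtrTerm γ I x j Y X := by
  have hγ' := hγ (jac Y x) fun i => jac (X (Fin.castAdd u i)) x
  have hlie : CE.lieMul (chiMul (γ.smulRight I)) Y X x
      = (2 : ℝ) • (⁅Y, chiMul (γ.smulRight I) X⁆ : Sec m V) x
        - ∑ k, chiMul (γ.smulRight I) (Function.update X k ⁅Y, X k⁆) x :=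
    congrArg _ (map_sum (Sec.eval x) _ _)
  rw [hlie, Sec.lie_apply, fderiv_chiMul_smulRight, Fin.sum_univ_add, chiMul_smulRight_apply,
    map_smul, hI]
  simp only [jacTerm, dtrTerm, chiMul_smulRight_apply, (update_jac X _ _ x).1,
    (update_jac X _ _ x).2, (update_dtr X _ _ x).1, (update_dtr X _ _ x).2, Vect.jac_lie, dtr_lie,
    Sec.sub_apply, Sec.lie_apply (V := Cov m),
    ContinuousAlternatingMap.map_update_sub, ContinuousAlternatingMap.map_update_add,
    Finset.sum_sub_distrib, Finset.sum_add_distrib, smul_sub, smul_add, sub_smul, add_smul,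
    ← Finset.sum_smul, ← Finset.smul_sum] at hγ' ⊢
  rw [sub_eq_zero.1 hγ']
  simp only [jac_apply]
  module

theorem alternatization_chiMul_mem_cocycles {γ : Gl m [⋀^Fin t]→L[ℝ] ℝ} (hγ : γ ∈ glInv m t)
    {I : Cov m [⋀^Fin u]→L[ℝ] V} (hI : IsGlEquivariant I) :
    MultilinearMap.alternatization (chiMul (γ.smulRight I))
      ∈ CE.cocycles ℝ (Vect m) (Sec m V) (t + u) := by
  refine LinearMap.mem_ker.2 (AlternatingMap.ext fun X => Sec.ext fun x => ?_)
  refine CE.map_d_alternatization_eq_zero (Sec.eval x) (chiMul (γ.smulRight I))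
    (Sum.elim (jacTerm γ I x) (dtrTerm γ I x)) (Sum.elim (Fin.castAdd u) (Fin.natAdd t))
    (fun Y X => ?_) (fun k Y X => ?_) X
  · rw [Fintype.sum_sum_type]
    exact lieMul_chiMul hγ hI Y X x
  · cases k with
    | inl i => exact jacTerm_update γ I x i Y X
    | inr j => exact dtrTerm_update γ I x j Y X

theorem χ_smulRight_mem_cocycles {γ : Gl m [⋀^Fin t]→L[ℝ] ℝ} (hγ : γ ∈ glInv m t)
    {I : Cov m [⋀^Fin u]→L[ℝ] V} (hI : IsGlEquivariant I) :
    χ (γ.smulRight I) ∈ CE.cocycles ℝ (slProj m) (Sec m V) (t + u) :=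
  Submodule.smul_mem _ _
    (CE.compLinearMap_incl_mem_cocycles (slProj m) (alternatization_chiMul_mem_cocycles hγ hI))

end ChiCocycle

section Connecting

variable {m : ℕ} {V W : Type} [NormedAddCommGroup V] [NormedSpace ℝ V]
  [NormedAddCommGroup W] [NormedSpace ℝ W] [GlRep m V]

/-- `opCorr X` at the point `x`, as a linear function of the value of the symbol at `x`. -/
def opCorrAt (X : Vect m) (x : Eu m) : (Cov m →L[ℝ] V →L[ℝ] W) →ₗ[ℝ] (V →L[ℝ] W) where
  toFun h := ∑ i, (h (dx i)).comp (GlRep.act (fderiv ℝ (fderiv ℝ X.1) x (ebasis i)))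
  map_add' h h' := by
    simp only [_root_.add_apply, ContinuousLinearMap.add_comp, Finset.sum_add_distrib]
  map_smul' r h := by
    simp only [_root_.smul_apply, ContinuousLinearMap.smul_comp, Finset.smul_sum, RingHom.id_apply]

theorem opCorr_apply (X : Vect m) (s : Symb1 m V W) (x : Eu m) :
    opCorr X s x = opCorrAt X x (s x) := rfl

theorem opCorr_zero (X : Vect m) : opCorr X (0 : Symb1 m V W) = 0 :=
  Sec.ext fun x => map_zero (opCorrAt X x)

variable [GlRep m W] (g : LieSubalgebra ℝ (Vect m))

/-- `mulOp` as a map of `g`-modules. -/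
def mulOpHom : Sec m (V →L[ℝ] W) →ₗ⁅ℝ, g⁆ DiffOp0 m V W where
  __ := mulOp
  map_lie' {X a} := Subtype.ext (by
    change op ⁅X.1, a⁆ 0 = ⁅X.1, op a 0⁆
    rw [lie_op, lie_zero, opCorr_zero, add_zero])

theorem mulOp_compAlternatingMap_mem_cocycles {n : ℕ} {c : g [⋀^Fin n]→ₗ[ℝ] Sec m (V →L[ℝ] W)}
    (hc : c ∈ CE.cocycles ℝ g (Sec m (V →L[ℝ] W)) n) :
    mulOp.compAlternatingMap c ∈ CE.cocycles ℝ g (DiffOp0 m V W) n := by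
  refine LinearMap.mem_ker.2 ((CE.d_comp (mulOpHom g) c).trans ?_)
  rw [LinearMap.mem_ker.1 hc]
  exact AlternatingMap.ext fun _ => map_zero (mulOpHom g)

/-- The differential operator of order one, without zeroth-order term, of a given symbol. -/
def liftOp : Symb1 m V W →ₗ[ℝ] DiffOp1 m V W where
  toFun s := ⟨op 0 s, s, 0, rfl⟩
  map_add' s s' := Subtype.ext (by simpa using op_add (0 : Sec m (V →L[ℝ] W)) 0 s s')
  map_smul' r s := Subtype.ext (by simpa using op_smul r (0 : Sec m (V →L[ℝ] W)) s)

theorem symbolD_liftOp (s : Symb1 m V W) : symbolD V W g (liftOp s) = s := symbolD_eq g rfl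

theorem lie_liftOp (X : g) (s : Symb1 m V W) :
    ⁅X, liftOp s⁆ = liftOp ⁅X, s⁆ + inclD V W g (mulOp (opCorr X.1 s)) := by
  refine Subtype.ext ?_
  change ⁅X.1, op 0 s⁆ = op 0 ⁅X.1, s⁆ + op (opCorr X.1 s) 0
  rw [lie_op, lie_zero, ← op_add, add_zero]

variable {g}

theorem d_liftOp_compAlternatingMap {n : ℕ} {c : g [⋀^Fin n]→ₗ[ℝ] Symb1 m V W}
    (hc : c ∈ CE.cocycles ℝ g (Symb1 m V W) n) (X : Fin (n + 1) → g) :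
    CE.d n (liftOp.compAlternatingMap c) X = inclD V W g (mulOp
      (∑ i : Fin (n + 1), (-1 : ℝ) ^ (i : ℕ) • opCorr (X i).1 (c (i.removeNth X)))) := by
  have h := congrArg (fun b => liftOp (b X)) (LinearMap.mem_ker.1 hc)
  simp only [CE.d_apply, AlternatingMap.zero_apply, map_zero, map_sum, map_smul, map_sub] at h
  simp only [CE.d_apply, LinearMap.compAlternatingMap_apply, lie_liftOp, map_sum, map_smul,
    add_sub_right_comm, smul_add, Finset.sum_add_distrib, h, zero_add]

theorem θ_cls_eq_smul_cls {n : ℕ} {c : g [⋀^Fin n]→ₗ[ℝ] Symb1 m V W}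
    (hc : c ∈ CE.cocycles ℝ g (Symb1 m V W) n) {e : g [⋀^Fin (n + 1)]→ₗ[ℝ] Sec m (V →L[ℝ] W)}
    (he : mulOp.compAlternatingMap e ∈ CE.cocycles ℝ g (DiffOp0 m V W) (n + 1)) {k : ℝ}
    (h : ∀ X : Fin (n + 1) → g,
      ∑ i : Fin (n + 1), (-1 : ℝ) ^ (i : ℕ) • opCorr (X i).1 (c (i.removeNth X)) = k • e X) :
    θ V W g n (CE.cls c hc) = k • CE.cls _ he := by
  have hs : (symbolD V W g : _ →ₗ[ℝ] _).compAlternatingMap (liftOp.compAlternatingMap c) = c :=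
    AlternatingMap.ext fun X => symbolD_liftOp g (c X)
  have hb : (inclD V W g : _ →ₗ[ℝ] _).compAlternatingMap (k • mulOp.compAlternatingMap e)
      = CE.d n (liftOp.compAlternatingMap c) := by
    ext1 X
    rw [d_liftOp_compAlternatingMap hc, h, map_smul mulOp]
    rfl
  exact CE.connecting_cls _ _ _ c hc _ hs _ hb (Submodule.smul_mem _ k he)

end Connecting

section Contractions

variable {m : ℕ}

theorem lam_act_apply {p : ℕ} (A : Gl m) (T : Lam m p) (β : Fin p → Cov m) :
    GlRep.act A T β = ∑ j, T (Function.update β j ((β j).comp A)) :=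
  lamAct_apply A T β

theorem cov_act (A : Gl m) (η : Cov m) : GlRep.act A η = -η.comp A := rfl

theorem act_contr {p : ℕ} (A : Gl m) (α : Cov m) (T : Lam m (p + 1)) :
    GlRep.act A (contr p α T) = contr p α (GlRep.act A T) + contr p (GlRep.act A α) T := by
  ext β
  have update_head : Function.update (Matrix.vecCons α β) 0 (α.comp A)
      = Matrix.vecCons (α.comp A) β := Fin.update_cons_zero _ _ _
  have update_tail : ∀ j, Function.update (Matrix.vecCons α β) (Fin.succ j) ((β j).comp A)
      = Matrix.vecCons α (Function.update β j ((β j).comp A)) := fun j =>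
    (Fin.cons_update _ _ _ _).symm
  rw [ContinuousAlternatingMap.add_apply, lam_act_apply, contr_apply, lam_act_apply,
    Fin.sum_univ_succ, cov_act, map_neg]
  simp only [_root_.neg_apply, ContinuousAlternatingMap.neg_apply, contr_apply,
    Matrix.cons_val_zero, Matrix.cons_val_succ, update_head, update_tail]
  abel

theorem act_contrIter (q n : ℕ) (A : Gl m) (α : Fin n → Cov m) (T : Lam m (q + n)) :
    GlRep.act A (contrIter q n α T) = contrIter q n α (GlRep.act A T)
      + ∑ j, contrIter q n (Function.update α j (GlRep.act A (α j))) T := by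
  induction n with
  | zero => exact (add_zero _).symm
  | succ n ih =>
    have update_last (j : Fin n) (η : Cov m) :
        Function.update α j.castSucc η (Fin.last n) = α (Fin.last n) :=
      Function.update_of_ne (Fin.castSucc_lt_last j).ne' _ _
    simp only [contrIter_succ, ContinuousLinearMap.comp_apply, Fin.sum_univ_castSucc,
      Fin.init_update_last, Fin.init_update_castSucc, Function.update_self, update_last]
    rw [ih, act_contr, map_add, add_right_comm, add_assoc]
    rfl

theorem isGlEquivariant_I₀ (q n : ℕ) : IsGlEquivariant (m := m) (I₀ q n) := fun A α => by
  ext1 T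
  rw [glRepHom_apply, _root_.sum_apply]
  exact sub_eq_iff_eq_add'.2 (act_contrIter q n A α T)

theorem isGlEquivariant_I₁ (q r : ℕ) :
    IsGlEquivariant (V := Cov m →L[ℝ] Lam m (q + (r + 1)) →L[ℝ] Lam m q) (I₁ q r) := fun A α => by
  ext1 η
  have h := isGlEquivariant_I₀ q (r + 1) A (Matrix.vecCons η α)
  have update_head : Function.update (Matrix.vecCons η α) 0 (GlRep.act A η)
      = Matrix.vecCons (GlRep.act A η) α := Fin.update_cons_zero _ _ _
  have update_tail : ∀ j, Function.update (Matrix.vecCons η α) (Fin.succ j) (GlRep.act A (α j))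
      = Matrix.vecCons η (Function.update α j (GlRep.act A (α j))) := fun j =>
    (Fin.cons_update _ _ _ _).symm
  rw [Fin.sum_univ_succ] at h
  simp only [Matrix.cons_val_zero, Matrix.cons_val_succ, update_head, update_tail] at h
  rw [glRepHom_apply, _root_.sum_apply]
  exact sub_eq_iff_eq_add'.2 h

theorem contrIter_vecCons (q n : ℕ) (η : Cov m) (α : Fin n → Cov m) (T : Lam m (q + n + 1)) :
    contrIter q (n + 1) (Matrix.vecCons η α) T
      = (-1 : ℝ) ^ n • contrIter q n α (contr (q + n) η T) := by
  induction n with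
  | zero => exact (one_smul ℝ _).symm.trans (congrArg (· • _) (pow_zero _).symm)
  | succ n ih =>
    have init_vecCons : Fin.init (Matrix.vecCons η α : Fin (n + 2) → Cov m)
        = Matrix.vecCons η (Fin.init α) := by
      ext1 k
      cases k using Fin.cases <;> rfl
    rw [contrIter_succ, ContinuousLinearMap.comp_apply, init_vecCons]
    refine (ih (Fin.init α) (contr (q + n + 1) (α (Fin.last n)) T)).trans ?_
    rw [contr_contr, map_neg, smul_neg, pow_succ, mul_neg_one, neg_smul]
    rfl

theorem sum_smul_contr_dx {p : ℕ} (η : Cov m) (T : Lam m (p + 1)) :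
    ∑ i, η (ebasis i) • contr p (dx i) T = contr p η T := by
  conv_rhs => rw [Cov.eq_sum η, map_sum, _root_.sum_apply]
  exact Finset.sum_congr rfl fun i _ =>
    (congrArg (· T) (map_smul (contr p) (η (ebasis i)) (dx i))).symm

theorem contr_update_self {p : ℕ} (α : Cov m) (T : Lam m (p + 1)) (β : Fin p → Cov m) (j : Fin p) :
    contr p (β j) T (Function.update β j α) = -contr p α T β := by
  refine Eq.trans (congrArg T (funext fun k => ?_))
    (T.map_swap (Matrix.vecCons α β) (Fin.succ_ne_zero j))
  rw [Function.comp_apply]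
  rcases eq_or_ne k 0 with rfl | hk
  · simp
  rcases eq_or_ne k j.succ with rfl | hj
  · simp
  · obtain ⟨k, rfl⟩ := Fin.exists_succ_eq.2 hk
    rw [Equiv.swap_apply_of_ne_of_ne hj hk]
    exact Function.update_of_ne (fun h => hj (congrArg Fin.succ h)) α β

/-- The second derivative `w ↦ α(w) v + α(v) w` of the quadratic field `x ↦ α(x) x` in the
direction `v`. -/
def quadHess (α : Cov m) (v : Eu m) : Gl m := α.smulRight v + α v • ContinuousLinearMap.id ℝ (Eu m)

theorem comp_quadHess (η α : Cov m) (v : Eu m) : η.comp (quadHess α v) = η v • α + α v • η := by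
  ext w
  simp [quadHess, mul_comm]

theorem act_quadHess_apply {p : ℕ} (α : Cov m) (v : Eu m) (T : Lam m p) (β : Fin p → Cov m) :
    GlRep.act (quadHess α v) T β
      = ∑ j, (β j v * T (Function.update β j α) + α v * T β) := by
  simp only [lam_act_apply, comp_quadHess, T.map_update_add, T.map_update_smul,
    Function.update_eq_self, smul_eq_mul]

theorem sum_act_quadHess_contr_dx {p : ℕ} (α : Cov m) (T : Lam m (p + 1)) :
    ∑ i, GlRep.act (quadHess α (ebasis i)) (contr p (dx i) T) = 0 := by
  ext β
  have sum_mul (η : Cov m) (β : Fin p → Cov m) :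
      ∑ i, η (ebasis i) * contr p (dx i) T β = contr p η T β := by
    simp only [← sum_smul_contr_dx η T, ContinuousAlternatingMap.sum_apply,
      ContinuousAlternatingMap.smul_apply, smul_eq_mul]
  simp only [ContinuousAlternatingMap.sum_apply, act_quadHess_apply]
  rw [Finset.sum_comm]
  refine Finset.sum_eq_zero fun j _ => ?_
  rw [Finset.sum_add_distrib, sum_mul, sum_mul, contr_update_self, neg_add_cancel]

theorem act_quadHess_dx (α : Cov m) (i : Fin m) :
    GlRep.act (quadHess α (ebasis i)) (dx i) = -(α + α (ebasis i) • dx i) := by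
  have dx_ebasis : dx i (ebasis i) = 1 := Pi.single_eq_same (M := fun _ => ℝ) i 1
  rw [cov_act, comp_quadHess, dx_ebasis, one_smul]

theorem sum_contr_act_quadHess {p : ℕ} (α : Cov m) (T : Lam m (p + 1)) :
    ∑ i, contr p (dx i) (GlRep.act (quadHess α (ebasis i)) T) = ((m : ℝ) + 1) • contr p α T := by
  have leibniz (i : Fin m) : contr p (dx i) (GlRep.act (quadHess α (ebasis i)) T)
      = GlRep.act (quadHess α (ebasis i)) (contr p (dx i) T)
        + (contr p α T + α (ebasis i) • contr p (dx i) T) := by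
    rw [act_contr, act_quadHess_dx]
    simp only [map_neg, map_add, map_smul, _root_.neg_apply, _root_.add_apply, _root_.smul_apply,
      neg_add_cancel_right]
  simp only [leibniz, Finset.sum_add_distrib, sum_act_quadHess_contr_dx, sum_smul_contr_dx,
    Finset.sum_const, Finset.card_univ, Fintype.card_fin, zero_add, add_smul, one_smul,
    Nat.cast_smul_eq_nsmul]

theorem fderiv_fderiv_projField (h : Eu m) (A : Gl m) (α : Cov m) (x v : Eu m) :
    fderiv ℝ (fderiv ℝ (hField h + AField A + αField α).1) x v = quadHess α v := by
  set X := hField h + AField A + αField α with hX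
  ext1 w
  have h1 := (X.diff_fderiv x).hasFDerivAt.clm_apply (hasFDerivAt_const w x)
  have h2 : HasFDerivAt (fun y => fderiv ℝ X.1 y w)
      (α w • ContinuousLinearMap.id ℝ (Eu m) + α.smulRight w) x := by
    simp only [hX, fderiv_projField]
    exact (((hasFDerivAt_id x).const_smul (α w)).add (α.hasFDerivAt.smul_const w)).const_add _
  simpa [quadHess] using congrArg (· v) (h1.unique h2)

theorem traceGl_quadHess (α : Cov m) (v : Eu m) : traceGl m (quadHess α v) = (m + 1) * α v := by
  have trace_smulRight : traceGl m (α.smulRight v) = α v :=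
    LinearMap.trace_smulRight (α : Eu m →ₗ[ℝ] ℝ) v
  have trace_id : traceGl m (ContinuousLinearMap.id ℝ (Eu m)) = m := by
    rw [traceGl_apply, ContinuousLinearMap.coe_id, LinearMap.trace_id, Module.finrank_fin_fun]
  rw [quadHess, map_add, map_smul, trace_smulRight, trace_id, smul_eq_mul]
  ring

theorem dtr_projField (h : Eu m) (A : Gl m) (α : Cov m) (x : Eu m) :
    dtr (hField h + AField A + αField α) x = ((m : ℝ) + 1) • α := by
  ext1 v
  rw [dtr_apply_eq_traceGl, fderiv_fderiv_projField, traceGl_quadHess]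
  rfl

theorem opCorrAt_I₁ (q r : ℕ) (X : slProj m) (x : Eu m) (β : Fin r → Cov m) :
    opCorrAt X.1 x (I₁ q r β) = I₀ q (r + 1) (Matrix.vecCons (dtr X.1 x) β) := by
  obtain ⟨_, h, A, α, rfl⟩ := X
  ext1 T
  have contr_smul : contr (q + r) (((m : ℝ) + 1) • α) T = ((m : ℝ) + 1) • contr (q + r) α T := by
    rw [ContinuousLinearMap.map_smul]
    rfl
  calc opCorrAt (hField h + AField A + αField α) x (I₁ q r β) T
    _ = ∑ i, contrIter q (r + 1) (Matrix.vecCons (dx i) β)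
          (GlRep.act (quadHess α (ebasis i)) T) := by
      simp only [opCorrAt, LinearMap.coe_mk, AddHom.coe_mk, fderiv_fderiv_projField]
      exact _root_.sum_apply _ _ _
    _ = (-1 : ℝ) ^ r • contrIter q r β
          (∑ i, contr (q + r) (dx i) (GlRep.act (quadHess α (ebasis i)) T)) := by
      rw [map_sum, Finset.smul_sum]
      exact Finset.sum_congr rfl fun i _ => contrIter_vecCons q r (dx i) β _
    _ = (-1 : ℝ) ^ r • contrIter q r β (contr (q + r) (((m : ℝ) + 1) • α) T) := by
      rw [sum_contr_act_quadHess, contr_smul]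
    _ = I₀ q (r + 1) (Matrix.vecCons (dtr (hField h + AField A + αField α) x) β) T := by
      rw [dtr_projField, I₀_apply]
      exact (contrIter_vecCons q r _ β T).symm

end Contractions

section Computation

variable {m : ℕ} {V : Type} [NormedAddCommGroup V] [NormedSpace ℝ V] {t u : ℕ}

/-- The value at `x` of the product `γ(DY₁, …, DY_t) I(d tr DZ₁, …, d tr DZ_u)`, whose
antisymmetrization is, up to a factor, `χ(γ ⊗ I)`. -/
def jacDtr (γ : Gl m [⋀^Fin t]→L[ℝ] ℝ) (I : Cov m [⋀^Fin u]→L[ℝ] V) (x : Eu m)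
    (Y : Fin t → slProj m) (Z : Fin u → slProj m) : V :=
  γ (fun i => jac (Y i).1 x) • I (fun j => dtr (Z j).1 x)

theorem χ_smulRight_apply (γ : Gl m [⋀^Fin t]→L[ℝ] ℝ) (I : Cov m [⋀^Fin u]→L[ℝ] V)
    (X : Fin (t + u) → slProj m) (x : Eu m) :
    χ (γ.smulRight I) X x = ((-1 : ℝ) ^ t / (t.factorial * u.factorial * ((m : ℝ) + 1) ^ u)) •
      antisymmetrize (fun y => jacDtr γ I x (y ∘ Fin.castAdd u) (y ∘ Fin.natAdd t)) X :=
  χ_apply _ _ _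

theorem opCorrAt_jacDtr_I₁ (q r : ℕ) (γ : Gl m [⋀^Fin t]→L[ℝ] ℝ) (X : slProj m) (x : Eu m)
    (Y : Fin t → slProj m) (Z : Fin r → slProj m) :
    opCorrAt X.1 x (jacDtr γ (I₁ q r) x Y Z)
      = jacDtr γ (I₀ q (r + 1)) x Y (Matrix.vecCons X Z) := by
  have dtr_vecCons : (fun j => dtr (Matrix.vecCons X Z j).1 x)
      = Matrix.vecCons (dtr X.1 x) fun j => dtr (Z j).1 x := by
    ext1 j
    cases j using Fin.cases <;> rfl
  rw [jacDtr, jacDtr, dtr_vecCons, ← opCorrAt_I₁]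
  exact (opCorrAt X.1 x).map_smul _ _

theorem opCorr_χ_I₁_apply (q r : ℕ) (γ : Gl m [⋀^Fin t]→L[ℝ] ℝ) (Y : slProj m)
    (X : Fin (t + r) → slProj m) (x : Eu m) :
    opCorr Y.1 (χ (γ.smulRight (I₁ q r)) X) x
      = ((-1 : ℝ) ^ t / (t.factorial * r.factorial * ((m : ℝ) + 1) ^ r)) •
        antisymmetrize (fun y => jacDtr γ (I₀ q (r + 1)) x (y ∘ Fin.castAdd r)
          (Matrix.vecCons Y (y ∘ Fin.natAdd t))) X := by
  rw [opCorr_apply, χ_smulRight_apply, map_smul, map_antisymmetrize]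
  simp only [opCorrAt_jacDtr_I₁]

theorem sum_opCorr_χ_I₁ (q r : ℕ) (γ : Gl m [⋀^Fin t]→L[ℝ] ℝ) (X : Fin (t + r + 1) → slProj m) :
    ∑ i : Fin (t + r + 1), (-1 : ℝ) ^ (i : ℕ) •
        opCorr (X i).1 (χ (γ.smulRight (I₁ q r)) (i.removeNth X))
      = ((-1 : ℝ) ^ t * ((r : ℝ) + 1) * ((m : ℝ) + 1)) • χ (γ.smulRight (I₀ q (r + 1))) X := by
  ext1 x
  rw [← Sec.eval_apply, map_sum]
  simp only [map_smul, Sec.eval_apply, opCorr_χ_I₁_apply, smul_comm ((-1 : ℝ) ^ (_ : ℕ)) (_ : ℝ)]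
  rw [← Finset.smul_sum, sum_antisymmetrize_removeNth (jacDtr γ (I₀ q (r + 1)) x), Sec.smul_apply]
  refine Eq.trans ?_ (congrArg _ (χ_smulRight_apply γ (I₀ q (r + 1)) X x).symm)
  rw [smul_smul, smul_smul, Nat.factorial_succ]
  congr 1
  push_cast
  field_simp
  ring

end Computation

end

theorem lemma3p2 (m q r a : ℕ) (γ : Gl m [⋀^Fin a]→L[ℝ] ℝ) (hγ : γ ∈ glInv m a) :
    ∃ (h₁ : χ (γ.smulRight (I₁ q r)) ∈
          CE.cocycles ℝ (slProj m) (Symb1 m (Lam m (q + (r + 1))) (Lam m q)) (a + r))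
      (h₀ : mulOp.compAlternatingMap (χ (γ.smulRight (I₀ q (r + 1)))) ∈
          CE.cocycles ℝ (slProj m) (DiffOp0 m (Lam m (q + (r + 1))) (Lam m q)) (a + r + 1)),
      θ (Lam m (q + (r + 1))) (Lam m q) (slProj m) (a + r) (CE.cls _ h₁)
        = ((-1 : ℝ) ^ a * (((q + (r + 1) : ℕ) : ℝ) - (q : ℝ)) * ((m : ℝ) + 1)) • CE.cls _ h₀ := by
  have sub_eq : ((q + (r + 1) : ℕ) : ℝ) - (q : ℝ) = r + 1 := by
    push_cast
    ring
  refine ⟨χ_smulRight_mem_cocycles hγ (isGlEquivariant_I₁ q r),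
    mulOp_compAlternatingMap_mem_cocycles (slProj m)
      (χ_smulRight_mem_cocycles hγ (isGlEquivariant_I₀ q (r + 1))),
    θ_cls_eq_smul_cls _ _ ?_⟩
  rw [sub_eq]
  exact sum_opCorr_χ_I₁ q r γ
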